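/- Let $d>1$ and $n\ge 1$ be integers, and let $G=G(d,1,n)\subset GL_n(\mathbb C)$ be the group of $n\times n$ monomial matrices (exactly one nonzero entry in each row and column) whose nonzero entries are complex $d$th roots of unity. For $u\in G$ let $\operatorname{fix}(u)=\{v\in\mathbb C^n: uv=v\}$; $u$ is a reflection if $\dim\operatorname{fix}(u)=n-1$. An element of $G$ is regular if it has an eigenvector that lies in $\operatorname{fix}(r)$ for no reflection $r\in G$; if the eigenvalue of such an eigenvector is a primitive $m$th root of unity, the integer $m$ is called regular. The Coxeter number $h$ of $G$ is the largest regular integer, and a Coxeter element of $G$ is a regular element of order $h$. Let $c$ be any Coxeter element of $G$ and, for $k\ge 1$ and $r_1,\dots,r_k\ge 0$, let $a^{(d)}_{r_1,\dots,r_k}$ be the number of tuples $(u_1,\dots,u_k)\in G^k$ with $u_1\cdots u_k=c$ and $\dim\operatorname{fix}(u_i)=r_i$ for all $i$. Put $$(x-1)^{(d)}_p=\prod_{j=0}^{p-1}(x-1-jd),\qquad M^n_{p_1,\dots,p_k}=\sum_{t=0}^{\min_i p_i}(-1)^t\binom nt\prod_{i=1}^k\binom{n-t}{p_i-t}.$$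 Then, as identities of polynomials (all sums having finitely many nonzero terms), $$\frac1{|G|}\sum_{r,s\ge0}a^{(d)}_{r,s}x^ry^s=\sum_{p,q\ge0}\binom{n}{p;\,q;\,n-p-q}\frac{(x-1)^{(d)}_p}{d^p\,p!}\,\frac{(y-1)^{(d)}_q}{d^q\,q!},$$ where $\binom{n}{p;q;n-p-q}=\frac{n!}{p!\,q!\,(n-p-q)!}$ if $p+q\le n$ and $0$ otherwise, and more generally, for every $k\ge1$, $$\frac1{|G|^{k-1}}\sum_{r_1,\dots,r_k\ge0}a^{(d)}_{r_1,\dots,r_k}x_1^{r_1}\cdots x_k^{r_k}=\sum_{p_1,\dots,p_k\ge0}M^n_{p_1,\dots,p_k}\prod_{i=1}^k\frac{(x_i-1)^{(d)}_{p_i}}{d^{p_i}\,p_i!}.$$ -/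

import Mathlib

open scoped BigOperators MatrixGroups

noncomputable section

namespace ReflFact

/-- The generalized permutation matrix `[π; a]`: column `j` has its only nonzero entry `a j` in
row `π j`, and this entry is a complex `d`-th root of unity. -/
def monomialMatrix {d n : ℕ} (π : Equiv.Perm (Fin n)) (a : Fin n → rootsOfUnity d ℂ) :
    Matrix (Fin n) (Fin n) ℂ :=
  Matrix.of fun i j => if i = π j then ((a j : ℂˣ) : ℂ) else 0

theorem monomialMatrix_mul {d n : ℕ} (π σ : Equiv.Perm (Fin n))
    (a b : Fin n → rootsOfUnity d ℂ) :
    monomialMatrix π a * monomialMatrix σ b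
      = monomialMatrix (π * σ) (fun j => a (σ j) * b j) := by
  ext i j
  simp only [monomialMatrix, Matrix.mul_apply, Matrix.of_apply]
  rw [Finset.sum_eq_single (σ j)]
  · by_cases h : i = π (σ j) <;> simp [h]
  · intro k _ hk
    simp [hk]
  · simp

theorem monomialMatrix_one {d n : ℕ} :
    monomialMatrix (1 : Equiv.Perm (Fin n)) (fun _ => (1 : rootsOfUnity d ℂ)) = 1 := by
  ext i j
  by_cases h : i = j
  · subst h
    simp [monomialMatrix]
  · simp [monomialMatrix, h]

/-- The group `G(d, 1, n)` of `n × n` monomial matrices all of whose nonzero entries are complex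
`d`-th roots of unity. -/
def Gd1n (d n : ℕ) : Subgroup (GL (Fin n) ℂ) where
  carrier := {g | ∃ (π : Equiv.Perm (Fin n)) (a : Fin n → rootsOfUnity d ℂ),
    (g : Matrix (Fin n) (Fin n) ℂ) = monomialMatrix π a}
  one_mem' := ⟨1, fun _ => 1, by rw [monomialMatrix_one]; rfl⟩
  mul_mem' := by
    rintro g h ⟨π, a, hg⟩ ⟨σ, b, hh⟩
    exact ⟨π * σ, fun j => a (σ j) * b j, by
      rw [Units.val_mul, hg, hh, monomialMatrix_mul]⟩
  inv_mem' := by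
    rintro g ⟨π, a, hg⟩
    refine ⟨π⁻¹, fun j => (a (π⁻¹ j))⁻¹, ?_⟩
    apply Units.inv_eq_of_mul_eq_one_right
    rw [hg, monomialMatrix_mul]
    simpa using monomialMatrix_one

variable {n : ℕ}

/-- The fixed space `{v | g v = v}` of an invertible matrix acting on `ℂⁿ`. -/
def fixedSpace (g : GL (Fin n) ℂ) : Submodule ℂ (Fin n → ℂ) :=
  LinearMap.eqLocus (Matrix.toLin' (g : Matrix (Fin n) (Fin n) ℂ)) LinearMap.id

/-- The dimension of the fixed space. -/
def fixDim (g : GL (Fin n) ℂ) : ℕ := Module.finrank ℂ (fixedSpace g)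

/-- A reflection is an element whose fixed space is a hyperplane. -/
def IsReflection (g : GL (Fin n) ℂ) : Prop := fixDim g + 1 = n

/-- `v` is an eigenvector of `g` with eigenvalue `μ` that lies on the fixed hyperplane of no
reflection in `G`. -/
def IsRegularEigenvector (G : Subgroup (GL (Fin n) ℂ)) (g : GL (Fin n) ℂ) (μ : ℂ)
    (v : Fin n → ℂ) : Prop :=
  Module.End.HasEigenvector (Matrix.toLin' (g : Matrix (Fin n) (Fin n) ℂ)) μ v ∧
    ∀ r ∈ G, IsReflection r → v ∉ fixedSpace r

/-- An element of `G` is regular if it has a regular eigenvector. -/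
def IsRegularElement (G : Subgroup (GL (Fin n) ℂ)) (g : GL (Fin n) ℂ) : Prop :=
  g ∈ G ∧ ∃ (μ : ℂ) (v : Fin n → ℂ), IsRegularEigenvector G g μ v

/-- An integer `m` is regular for `G` if some element of `G` has a regular eigenvector whose
eigenvalue is a primitive `m`-th root of unity. -/
def IsRegularNumber (G : Subgroup (GL (Fin n) ℂ)) (m : ℕ) : Prop :=
  ∃ g ∈ G, ∃ (μ : ℂ) (v : Fin n → ℂ), IsRegularEigenvector G g μ v ∧ IsPrimitiveRoot μ m

/-- `h` is the Coxeter number of `G`: the largest regular integer. -/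
def IsCoxeterNumber (G : Subgroup (GL (Fin n) ℂ)) (h : ℕ) : Prop :=
  IsGreatest {m : ℕ | IsRegularNumber G m} h

/-- A Coxeter element of `G` is a regular element whose order is the Coxeter number. -/
def IsCoxeterElement (G : Subgroup (GL (Fin n) ℂ)) (c : GL (Fin n) ℂ) : Prop :=
  IsRegularElement G c ∧ IsCoxeterNumber G (orderOf c)

/-- The number of factorizations `c = u₁ ⋯ u_k` with all `u_i` in `G` and `dim fix u_i = r_i`. -/
def factorCount (G : Subgroup (GL (Fin n) ℂ)) (c : GL (Fin n) ℂ) {k : ℕ} (r : Fin k → ℕ) : ℕ :=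
  Nat.card {u : Fin k → G //
    (List.ofFn fun i => (u i : GL (Fin n) ℂ)).prod = c ∧ ∀ i, fixDim (u i : GL (Fin n) ℂ) = r i}

/-- `M^n_{p₁,…,p_k} = ∑_{t=0}^{min p_i} (-1)^t C(n,t) ∏_i C(n-t, p_i-t)`. For `t > n` the factor
`C(n,t)` is zero, so the truncated subtraction is harmless. -/
def Mcoeff (n : ℕ) {k : ℕ} (p : Fin k → ℕ) : ℤ :=
  ∑ t ∈ Finset.range ((⨅ i, p i) + 1),
    (-1) ^ t * (n.choose t : ℤ) * ∏ i, ((n - t).choose (p i - t) : ℤ)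

/-- The trinomial coefficient `n! / (p! q! (n-p-q)!)`, zero when `p + q > n`. -/
def trinomial (n p q : ℕ) : ℕ :=
  if p + q ≤ n then Nat.multinomial Finset.univ ![p, q, n - p - q] else 0

/-- `(x - 1)^{(d)}_p = (x - 1)(x - 1 - d) ⋯ (x - 1 - (p - 1) d)` at the variable `x = x_i`. -/
def basisPoly {ι : Type} (d p : ℕ) (i : ι) : MvPolynomial ι ℚ :=
  ∏ j ∈ Finset.range p, (MvPolynomial.X i - 1 - MvPolynomial.C ((j : ℚ) * (d : ℚ)))

/-- `(x - 1)^{(d)}_p / (d^p p!)` at the variable `x = x_i`. -/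
def normBasisPoly {ι : Type} (d p : ℕ) (i : ι) : MvPolynomial ι ℚ :=
  MvPolynomial.C (((d : ℚ) ^ p * (p.factorial : ℚ))⁻¹) * basisPoly d p i

end ReflFact

end

/-! In the group algebra of G, factorizations are counted by products of the elements ∑ x_i^{dim fix
u} u, which are central because dim fix is a class function. For a character χ of the d-th roots of
unity, [π; a] ↦ χ(∏ a) π is a homomorphism into ℂ[S_n]. At x = 1 + dz it sends the weighted sum to
d^n times the Jucys–Murphy product ∏ (y + J), where y = z + 1 for trivial χ and y = z otherwise
(`twistedSum_eq`). A Coxeter element is some [π; a] with π a single n-cycle and ∏ a ≠ 1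
(`coxeter_structure`), and over an n-cycle the weighted count depends on a only through ∏ a. Fourier
inversion over χ thus leaves a difference of two coefficients at an n-cycle in ℂ[S_n], one with all
y_i = z_i + 1 and one with all y_i = z_i (`weightedCount_eq`).

Only hooks contribute to such coefficients, which is shown with explicit Young elements instead of
characters. Let A_S be the antisymmetrizer of S and B_T the symmetrizer of T. The alternating sum of
A_S B_{Sᶜ} over the S avoiding a point detects single-orbit permutations (`sum_coeff_hookElement`).
The multiple n A_S B_{Sᶜ} splits into elements A_S B_T whose S and T cover everything and share one
point (`card_smul_hookElement_compl`), and on these ∏ (y + J) acts by the content product of a hook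
(`jmProduct_mul_hookElement`). Hence n! times the coefficient is ∑ (-1)^r C(n-1,r) ∏_i ∏_{l<n} (y_i
+ l - r) (`factorial_mul_coeff`).

Replacing z + 1 by z shifts r by one, so Pascal's rule turns the difference into (n!)^k ∑ (-1)^t
C(n,t) ∏_i C(z_i+n-t, n). On the other side, (x-1)^{(d)}_p / (d^p p!) equals C(z,p) at x = 1 + dz,
and Vandermonde evaluates ∑ M ∏ C(z_i,p_i) to the same alternating sum (`sum_Mcoeff_mul`). The
polynomials agree on an infinite grid and so coincide. For k = 2, M is the trinomial coefficient
(`Mcoeff_pair`). -/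

noncomputable section

namespace ReflFact

open Equiv Finset

/-! ### Young symmetrizers -/

section

section YoungSums

variable {α : Type*} [Fintype α] [DecidableEq α]

/-- The permutations of `α` that fix every point outside `S`. -/
def permsOn (S : Finset α) : Finset (Perm α) := univ.filter fun π => ∀ i, i ∉ S → π i = i

/-- The sum of the permutations supported in `S`, weighted by the linear character `ε`. -/
def youngSum (ε : Perm α →* ℤˣ) (S : Finset α) : MonoidAlgebra ℂ (Perm α) :=
  ∑ π ∈ permsOn S, (((ε π : ℤˣ) : ℤ) : ℂ) • MonoidAlgebra.of ℂ (Perm α) π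

theorem mem_permsOn {S : Finset α} {π : Perm α} : π ∈ permsOn S ↔ ∀ i, i ∉ S → π i = i := by
  simp [permsOn]

theorem permsOn_apply_mem {S : Finset α} {π : Perm α} (h : π ∈ permsOn S) {i : α} :
    π i ∈ S ↔ i ∈ S := by
  rw [mem_permsOn] at h
  by_cases hi : i ∈ S
  · refine iff_of_true ?_ hi
    by_contra hc
    have h2 := π.injective (h _ hc)
    rw [h2] at hc
    exact hc hi
  · rw [h i hi]

theorem permsOn_mul {S : Finset α} {π σ : Perm α} (hπ : π ∈ permsOn S) (hσ : σ ∈ permsOn S) :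
    π * σ ∈ permsOn S := by
  rw [mem_permsOn] at *
  intro i hi
  rw [Perm.mul_apply, hσ i hi, hπ i hi]

theorem permsOn_inv {S : Finset α} {π : Perm α} (hπ : π ∈ permsOn S) : π⁻¹ ∈ permsOn S := by
  rw [mem_permsOn] at *
  intro i hi
  rw [Perm.inv_eq_iff_eq, hπ i hi]

theorem permsOn_mono {S T : Finset α} (h : S ⊆ T) : permsOn S ⊆ permsOn T := by
  intro π hπ
  rw [mem_permsOn] at *
  exact fun i hi => hπ i fun hS => hi (h hS)

theorem swap_mem_permsOn {S : Finset α} {i j : α} (hi : i ∈ S) (hj : j ∈ S) :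
    swap i j ∈ permsOn S := by
  rw [mem_permsOn]
  intro x hx
  exact swap_apply_of_ne_of_ne (by rintro rfl; exact hx hi) (by rintro rfl; exact hx hj)

theorem of_mul_youngSum (ε : Perm α →* ℤˣ) {S : Finset α} {σ : Perm α} (hσ : σ ∈ permsOn S) :
    MonoidAlgebra.of ℂ (Perm α) σ * youngSum ε S = (((ε σ : ℤˣ) : ℤ) : ℂ) • youngSum ε S := by
  rw [youngSum, mul_sum, smul_sum]
  refine sum_nbij' (fun π => σ * π) (fun π => σ⁻¹ * π) (fun π h => permsOn_mul hσ h)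
    (fun π h => permsOn_mul (permsOn_inv hσ) h) (by simp) (by simp) ?_
  intro π _
  rw [mul_smul_comm, ← map_mul, smul_smul, map_mul ε, Units.val_mul, Int.cast_mul, ← mul_assoc]
  congr 1
  have : (((ε σ : ℤˣ) : ℤ) : ℂ) * (((ε σ : ℤˣ) : ℤ) : ℂ) = 1 := by
    rw [← Int.cast_mul, ← Units.val_mul, Int.units_mul_self]; simp
  rw [this, one_mul]

theorem youngSum_mul_of (ε : Perm α →* ℤˣ) {S : Finset α} {σ : Perm α} (hσ : σ ∈ permsOn S) :
    youngSum ε S * MonoidAlgebra.of ℂ (Perm α) σ = (((ε σ : ℤˣ) : ℤ) : ℂ) • youngSum ε S := by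
  rw [youngSum, sum_mul, smul_sum]
  refine sum_nbij' (fun π => π * σ) (fun π => π * σ⁻¹) (fun π h => permsOn_mul h hσ)
    (fun π h => permsOn_mul h (permsOn_inv hσ)) (by simp) (by simp) ?_
  intro π _
  rw [smul_mul_assoc, ← map_mul, smul_smul, map_mul ε, Units.val_mul, Int.cast_mul, mul_left_comm]
  congr 1
  have : (((ε σ : ℤˣ) : ℤ) : ℂ) * (((ε σ : ℤˣ) : ℤ) : ℂ) = 1 := by
    rw [← Int.cast_mul, ← Units.val_mul, Int.units_mul_self]; simp
  rw [this, mul_one]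

theorem conj_youngSum (ε : Perm α →* ℤˣ) (S : Finset α) (g : Perm α) :
    MonoidAlgebra.of ℂ (Perm α) g * youngSum ε S * MonoidAlgebra.of ℂ (Perm α) g⁻¹
      = youngSum ε (S.map g.toEmbedding) := by
  rw [youngSum, youngSum, mul_sum, sum_mul]
  refine sum_nbij' (fun π => g * π * g⁻¹) (fun π => g⁻¹ * π * g) ?_ ?_ ?_ ?_ ?_
  · intro π h
    rw [mem_permsOn] at *
    intro i hi
    rw [Perm.mul_apply, Perm.mul_apply, h]
    · simp
    intro h'
    exact hi (mem_map.2 ⟨g⁻¹ i, h', by simp⟩)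
  · intro π h
    rw [mem_permsOn] at *
    intro i hi
    rw [Perm.mul_apply, Perm.mul_apply, h]
    · simp
    intro h'
    simp at h'
    exact hi h'
  · intro π _; group
  · intro π _; group
  · intro π _
    rw [mul_smul_comm, smul_mul_assoc, ← map_mul, ← map_mul, map_mul ε, map_mul ε, mul_right_comm,
      ← map_mul ε]
    simp

/-- Coset decomposition: ρ supported on S ∪ {a} is uniquely π (a i) with i = ρ⁻¹ a and π supported
on S. The coset i = a supplies the summand 1. -/
theorem youngSum_insert (ε : Perm α →* ℤˣ) {S : Finset α} {a : α} (ha : a ∉ S) :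
    youngSum ε (insert a S) = youngSum ε S *
      (1 + ∑ i ∈ S, (((ε (swap a i) : ℤˣ) : ℤ) : ℂ) • MonoidAlgebra.of ℂ (Perm α) (swap a i)) := by
  have h1 : (1 + ∑ i ∈ S, (((ε (swap a i) : ℤˣ) : ℤ) : ℂ) •
      MonoidAlgebra.of ℂ (Perm α) (swap a i)) = ∑ i ∈ insert a S,
        (((ε (swap a i) : ℤˣ) : ℤ) : ℂ) • MonoidAlgebra.of ℂ (Perm α) (swap a i) := by
    rw [sum_insert ha]
    simp [← Perm.one_def, MonoidAlgebra.one_def]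
  rw [h1, youngSum, youngSum, sum_mul_sum, ← sum_product']
  symm
  refine sum_nbij' (fun p => p.1 * swap a p.2) (fun ρ => (ρ * swap a (ρ⁻¹ a), ρ⁻¹ a)) ?_ ?_ ?_ ?_ ?_
  · rintro ⟨π, i⟩ h
    rw [mem_product] at h
    exact permsOn_mul (permsOn_mono (subset_insert _ _) h.1)
      (swap_mem_permsOn (mem_insert_self _ _) h.2)
  · intro ρ h
    have hi : ρ⁻¹ a ∈ insert a S := (permsOn_apply_mem (permsOn_inv h)).2 (mem_insert_self _ _)
    rw [mem_product]
    refine ⟨?_, hi⟩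
    have h2 := permsOn_mul h (swap_mem_permsOn (mem_insert_self _ _) hi)
    rw [mem_permsOn] at *
    intro j hj
    by_cases hja : j = a
    · subst hja; simp
    · exact h2 j (by simp [hja, hj])
  · rintro ⟨π, i⟩ h
    rw [mem_product] at h
    have : π a = a := mem_permsOn.1 h.1 a ha
    have h' : (π * swap a i)⁻¹ a = i := by
      rw [Perm.inv_eq_iff_eq, Perm.mul_apply, swap_apply_right, this]
    simp only [h']
    simp [mul_assoc]
  · intro ρ _
    simp [mul_assoc]
  · rintro ⟨π, i⟩ _
    simp only
    rw [smul_mul_smul_comm, ← map_mul, map_mul ε, Units.val_mul, Int.cast_mul]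

theorem commute_sum_swap {β : Type*} [DecidableEq β] {π : Perm β} {a : β} (hπ : π a = a) (X : Finset β)
    (hX : ∀ i, π i ∈ X ↔ i ∈ X) (c : β → ℂ) (hc : ∀ i, c (π i) = c i) :
    Commute (MonoidAlgebra.of ℂ (Perm β) π)
      (∑ i ∈ X, c i • MonoidAlgebra.of ℂ (Perm β) (swap a i)) := by
  rw [commute_iff_eq, mul_sum, sum_mul]
  refine sum_nbij' (fun i => π i) (fun i => π⁻¹ i) (fun i h => (hX i).2 h) ?_ (by simp) (by simp) ?_
  · intro i hi
    rw [← hX]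
    simpa using hi
  · intro i _
    rw [mul_smul_comm, smul_mul_assoc, ← map_mul, ← map_mul, hc]
    congr 2
    rw [Equiv.mul_swap_eq_swap_mul, hπ]

theorem youngSum_insert' (ε : Perm α →* ℤˣ) {S : Finset α} {a : α} (ha : a ∉ S) :
    youngSum ε (insert a S) =
      (1 + ∑ i ∈ S, (((ε (swap a i) : ℤˣ) : ℤ) : ℂ) • MonoidAlgebra.of ℂ (Perm α) (swap a i)) *
        youngSum ε S := by
  rw [youngSum_insert ε ha]
  refine (Commute.add_right (Commute.one_right _) ?_).eq
  rw [youngSum]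
  refine Commute.sum_left _ _ _ fun π hπ => Commute.smul_left ?_ _
  refine commute_sum_swap (mem_permsOn.1 hπ a ha) S (fun i => permsOn_apply_mem hπ) _ fun i => ?_
  have h : swap a (π i) = π * swap a i * π⁻¹ := by
    rw [Equiv.mul_swap_eq_swap_mul, mem_permsOn.1 hπ a ha]
    simp
  rw [h, map_mul, map_mul, mul_right_comm, ← map_mul ε]
  simp

/-- The Young element `A_S B_T` of the hook with antisymmetrized set `S` and symmetrized set `T`. -/
def hookElement (S T : Finset α) : MonoidAlgebra ℂ (Perm α) :=
  youngSum Perm.sign S * youngSum 1 T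

theorem conj_hookElement (S T : Finset α) (g : Perm α) :
    MonoidAlgebra.of ℂ (Perm α) g * hookElement S T * MonoidAlgebra.of ℂ (Perm α) g⁻¹
      = hookElement (S.map g.toEmbedding) (T.map g.toEmbedding) := by
  rw [hookElement, hookElement, ← conj_youngSum, ← conj_youngSum]
  have : MonoidAlgebra.of ℂ (Perm α) g⁻¹ * MonoidAlgebra.of ℂ (Perm α) g = 1 := by
    rw [← map_mul, inv_mul_cancel, map_one]
  simp only [mul_assoc]
  rw [← mul_assoc (MonoidAlgebra.of ℂ (Perm α) g⁻¹) (MonoidAlgebra.of ℂ (Perm α) g), this, one_mul]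

/-- The transpositions (a b) with a ∈ S, b ∉ S enter the first sum with sign -1 and the second with
sign +1, so they cancel and |Sᶜ| + |S| copies remain. This mirrors the splitting of the module
induced from sign ⊗ trivial into two hooks. -/
theorem card_smul_hookElement_compl (S : Finset α) :
    (Fintype.card α : ℂ) • hookElement S Sᶜ =
      ∑ b ∈ Sᶜ, hookElement (insert b S) Sᶜ + ∑ a ∈ S, hookElement S (insert a Sᶜ) := by
  have h1 : ∀ b ∈ Sᶜ, hookElement (insert b S) Sᶜ = hookElement S Sᶜ -
      ∑ a ∈ S, youngSum Perm.sign S * MonoidAlgebra.of ℂ (Perm α) (swap a b) *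
        youngSum 1 Sᶜ := by
    intro b hb
    rw [mem_compl] at hb
    rw [hookElement, youngSum_insert _ hb, mul_add, mul_one, add_mul, sub_eq_add_neg, hookElement,
      mul_sum, sum_mul, ← sum_neg_distrib]
    congr 1
    refine sum_congr rfl fun a ha => ?_
    have hab : b ≠ a := by rintro rfl; exact hb ha
    rw [Perm.sign_swap hab, swap_comm]
    simp
  have h2 : ∀ a ∈ S, hookElement S (insert a Sᶜ) = hookElement S Sᶜ +
      ∑ b ∈ Sᶜ, youngSum Perm.sign S * MonoidAlgebra.of ℂ (Perm α) (swap a b) *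
        youngSum 1 Sᶜ := by
    intro a ha
    rw [hookElement, youngSum_insert' _ (by simpa using ha), add_mul, one_mul, mul_add, hookElement,
      sum_mul, mul_sum]
    congr 1
    refine sum_congr rfl fun b hb => ?_
    simp [mul_assoc]
  rw [sum_congr rfl h1, sum_congr rfl h2, sum_sub_distrib, sum_add_distrib, sum_comm (s := Sᶜ)]
  rw [sum_const, sum_const, ← card_add_card_compl S, Nat.cast_add, add_smul, Nat.cast_smul_eq_nsmul,
    Nat.cast_smul_eq_nsmul]
  abel

end YoungSums

end

/-! ### Hook eigenvectors of the Jucys–Murphy product -/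

section

/-- Extend a permutation of `Fin n` to `Fin (n + 1)` along `Fin.succ`, fixing `0`. -/
def liftPerm (n : ℕ) : Perm (Fin n) →* Perm (Fin (n + 1)) where
  toFun e := Perm.decomposeFin.symm (0, e)
  map_one' := by
    ext i
    refine Fin.cases ?_ (fun j => ?_) i <;> simp
  map_mul' e f := by
    ext i
    refine Fin.cases ?_ (fun j => ?_) i <;> simp

@[simp] theorem liftPerm_zero {n : ℕ} (e : Perm (Fin n)) : liftPerm n e 0 = 0 := by
  simp [liftPerm]

@[simp] theorem liftPerm_succ {n : ℕ} (e : Perm (Fin n)) (i : Fin n) :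
    liftPerm n e i.succ = (e i).succ := by
  simp [liftPerm]

theorem decomposeFin_symm_eq {n : ℕ} (p : Fin (n + 1)) (e : Perm (Fin n)) :
    Perm.decomposeFin.symm (p, e) = swap 0 p * liftPerm n e := by
  ext i
  refine Fin.cases ?_ (fun j => ?_) i <;> simp

theorem sign_liftPerm {n : ℕ} (e : Perm (Fin n)) : Perm.sign (liftPerm n e) = Perm.sign e := by
  simp [liftPerm]

/-- The algebra map induced by `liftPerm`. -/
def liftAlg (n : ℕ) :
    MonoidAlgebra ℂ (Perm (Fin n)) →ₐ[ℂ] MonoidAlgebra ℂ (Perm (Fin (n + 1))) :=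
  MonoidAlgebra.lift ℂ _ (Perm (Fin n)) ((MonoidAlgebra.of ℂ _).comp (liftPerm n))

@[simp] theorem liftAlg_of {n : ℕ} (e : Perm (Fin n)) :
    liftAlg n (MonoidAlgebra.of ℂ _ e) = MonoidAlgebra.of ℂ _ (liftPerm n e) := by
  simp [liftAlg]

theorem liftAlg_youngSum {n : ℕ} (ε : Perm (Fin n) →* ℤˣ) (ε' : Perm (Fin (n + 1)) →* ℤˣ)
    (hε : ∀ e, ε' (liftPerm n e) = ε e) (S : Finset (Fin n)) :
    liftAlg n (youngSum ε S) = youngSum ε' (S.map (Fin.succEmb n)) := by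
  rw [youngSum, youngSum, map_sum]
  refine sum_nbij (fun e => liftPerm n e) ?_ ?_ ?_ ?_
  · intro e he
    rw [mem_permsOn] at *
    intro i
    refine Fin.cases ?_ (fun j hj => ?_) i
    · simp
    · rw [liftPerm_succ, he j]
      intro h
      exact hj (mem_map.2 ⟨j, h, rfl⟩)
  · intro e _ f _ h
    ext i
    have := congrArg (fun g : Perm (Fin (n + 1)) => g i.succ) h
    simpa [Fin.ext_iff] using this
  · intro ρ hρ
    rw [mem_coe, mem_permsOn] at hρ
    obtain ⟨⟨p, e⟩, rfl⟩ := Perm.decomposeFin.symm.surjective ρ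
    have h0 := hρ 0 (by simp)
    rw [Perm.decomposeFin_symm_apply_zero] at h0
    subst h0
    refine ⟨e, ?_, rfl⟩
    rw [mem_coe, mem_permsOn]
    intro i hi
    have := hρ i.succ (by simpa using hi)
    simpa using this
  · intro e _
    rw [map_smul, liftAlg_of, hε]

/-- The sum `∑_{p ≠ 0} (0 p)` of transpositions. -/
def jucysMurphy (n : ℕ) : MonoidAlgebra ℂ (Perm (Fin (n + 1))) :=
  ∑ p : Fin n, MonoidAlgebra.of ℂ _ (swap 0 p.succ)

/-- The product `∏ (y + J)` over the Jucys–Murphy elements of the symmetric group. -/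
def jmProduct (y : ℂ) : (n : ℕ) → MonoidAlgebra ℂ (Perm (Fin n))
  | 0 => 1
  | n + 1 => (y • 1 + jucysMurphy n) * liftAlg n (jmProduct y n)

theorem jmProduct_succ (y : ℂ) (n : ℕ) :
    jmProduct y (n + 1) = (y • 1 + jucysMurphy n) * liftAlg n (jmProduct y n) := rfl

/-- The content product of the hook with `n` boxes and leg length `r`. -/
def hookContent (n r : ℕ) (y : ℂ) : ℂ := ∏ l ∈ range n, (y + l - r)

/-- On the full antisymmetrizer the group algebra acts through the sign character, under which
`jucysMurphy n` becomes -n. -/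
theorem jmProduct_mul_sign (y : ℂ) (n : ℕ) :
    jmProduct y n * youngSum Perm.sign univ =
      (∏ l ∈ range n, (y - l)) • youngSum Perm.sign univ := by
  set s : (n : ℕ) → MonoidAlgebra ℂ (Perm (Fin n)) →ₐ[ℂ] ℂ := fun n =>
    MonoidAlgebra.lift ℂ _ (Perm (Fin n))
      (((Int.castRingHom ℂ : ℤ →* ℂ).comp (Units.coeHom ℤ)).comp Perm.sign) with hs
  have hof : ∀ n (e : Perm (Fin n)), s n (MonoidAlgebra.of ℂ _ e) = ((Perm.sign e : ℤˣ) : ℤ) := by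
    intro n e
    simp [hs]
  have h1 : ∀ x : MonoidAlgebra ℂ (Perm (Fin n)),
      x * youngSum Perm.sign univ = s n x • youngSum Perm.sign univ := by
    intro x
    induction x using MonoidAlgebra.induction_on with
    | of e => rw [of_mul_youngSum _ (mem_permsOn.2 (by simp)), hof]
    | add x y hx hy => rw [add_mul, hx, hy, map_add, add_smul]
    | smul c x hx => rw [smul_mul_assoc, hx, map_smul, smul_smul, smul_eq_mul]
  have h2 : ∀ n, s n (jmProduct y n) = ∏ l ∈ range n, (y - l) := by
    intro n
    induction n with
    | zero => simp [jmProduct]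
    | succ n ih =>
      have h3 : ∀ x, s (n + 1) (liftAlg n x) = s n x := by
        intro x
        induction x using MonoidAlgebra.induction_on with
        | of e => rw [liftAlg_of, hof, hof, sign_liftPerm]
        | add x y hx hy => rw [map_add, map_add, hx, hy, map_add]
        | smul c x hx => rw [map_smul, map_smul, hx, map_smul]
      rw [jmProduct_succ, map_mul, h3, ih, prod_range_succ, mul_comm, map_add, map_smul, map_one,
        jucysMurphy, map_sum]
      congr 1
      have : ∀ p : Fin n, s (n + 1) (MonoidAlgebra.of ℂ _ (swap 0 p.succ)) = -1 := by
        intro p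
        rw [hof, Perm.sign_swap (Fin.succ_ne_zero p).symm]
        simp
      rw [sum_congr rfl fun p _ => this p]
      simp [sub_eq_add_neg]
  rw [h1, h2]

/-- Standard position puts the leg on the last r + 1 points and the arm on the first n - r, with a
common corner. Induction on n starts from a single column; each new point 0 lengthens the arm by one
box, of content n - r. -/
theorem jmProduct_mul_hookElement_std (y : ℂ) (r n : ℕ) (hr : r < n) :
    jmProduct y n * hookElement (univ.filter fun i : Fin n => n ≤ (i : ℕ) + r + 1)
        (univ.filter fun i : Fin n => (i : ℕ) + r + 1 ≤ n) =
      hookContent n r y • hookElement (univ.filter fun i : Fin n => n ≤ (i : ℕ) + r + 1)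
        (univ.filter fun i : Fin n => (i : ℕ) + r + 1 ≤ n) := by
  induction n, hr using Nat.le_induction with
  | base =>
    have hS : (univ.filter fun i : Fin (r + 1) => r + 1 ≤ (i : ℕ) + r + 1) = univ := by
      ext i; simp
    rw [Nat.succ_eq_add_one, hS, hookElement, ← mul_assoc, jmProduct_mul_sign, smul_mul_assoc]
    congr 1
    rw [hookContent, ← prod_range_reflect]
    refine prod_congr rfl fun l hl => ?_
    rw [mem_range] at hl
    rw [show r + 1 - 1 - l = r - l by omega, Nat.cast_sub (by omega)]
    ring
  | succ n hn ih =>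
    rw [Nat.succ_le_iff] at hn
    set S := univ.filter fun i : Fin n => n ≤ (i : ℕ) + r + 1 with hSdef
    set T := univ.filter fun i : Fin n => (i : ℕ) + r + 1 ≤ n with hTdef
    have hS : (univ.filter fun i : Fin (n + 1) => n + 1 ≤ (i : ℕ) + r + 1) =
        S.map (Fin.succEmb n) := by
      ext i
      refine Fin.cases ?_ (fun j => ?_) i
      · simp; omega
      · simp [hSdef]; omega
    have hT : (univ.filter fun i : Fin (n + 1) => (i : ℕ) + r + 1 ≤ n + 1) =
        insert 0 (T.map (Fin.succEmb n)) := by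
      ext i
      refine Fin.cases ?_ (fun j => ?_) i
      · simp; omega
      · simp [hTdef, Fin.succ_ne_zero]; omega
    rw [hS, hT]
    set S' := S.map (Fin.succEmb n) with hS'
    set T' := T.map (Fin.succEmb n) with hT'
    have h0 : (0 : Fin (n + 1)) ∉ T' := by simp [hT']
    have h0S : (0 : Fin (n + 1)) ∉ S' := by simp [hS']
    have hA : youngSum Perm.sign S' = liftAlg n (youngSum Perm.sign S) :=
      (liftAlg_youngSum _ _ sign_liftPerm S).symm
    have hB : youngSum 1 T' = liftAlg n (youngSum 1 T) :=
      (liftAlg_youngSum _ _ (by simp) T).symm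
    have hmS : ∀ {i}, i ∈ S → i.succ ∈ S' := fun hi => mem_map_of_mem (Fin.succEmb n) hi
    have hmT : ∀ {i}, i ∈ T → i.succ ∈ insert 0 T' := fun hi =>
      mem_insert_of_mem (mem_map_of_mem (Fin.succEmb n) hi)
    have key : liftAlg n (jmProduct y n) * hookElement S' (insert 0 T') =
        hookContent n r y • hookElement S' (insert 0 T') := by
      rw [hookElement, youngSum_insert _ h0, hA, hB, ← mul_assoc, ← mul_assoc, ← map_mul,
        ← map_mul, mul_assoc, ← hookElement, ih, map_smul, hookElement, map_mul, smul_mul_assoc, mul_assoc]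
    have hJ : jucysMurphy n * hookElement S' (insert 0 T') =
        ((n : ℂ) - r) • hookElement S' (insert 0 T') := by
      -- The corner of the hook, common to leg and arm.
      obtain ⟨a, haS, haT⟩ : ∃ a : Fin n, a ∈ S ∧ a ∈ T :=
        ⟨⟨n - r - 1, by omega⟩, by simp [hSdef]; omega, by simp [hTdef]; omega⟩
      have hcomm : Commute (youngSum Perm.sign S') (jucysMurphy n) := by
        -- Including the trivial swap (0 0) = 1 makes the index set all of `Fin (n + 1)`, which
        -- every permutation preserves.
        have hJ1 : jucysMurphy n = ∑ i ∈ univ, (1 : ℂ) • MonoidAlgebra.of ℂ _ (swap 0 i) - 1 := by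
          rw [Fin.sum_univ_succ, jucysMurphy]
          simp [← Perm.one_def, MonoidAlgebra.one_def]
        rw [hJ1, youngSum]
        refine Commute.sum_left _ _ _ fun π hπ => Commute.smul_left ?_ _
        exact (commute_sum_swap (mem_permsOn.1 hπ 0 h0S) univ (by simp) (fun _ => 1)
          (by simp)).sub_right (Commute.one_right _)
      have hterm : ∀ p : Fin n, youngSum Perm.sign S' * MonoidAlgebra.of ℂ _ (swap 0 p.succ) *
          youngSum 1 (insert 0 T') = if p ∈ T then hookElement S' (insert 0 T') else 0 := by
        intro p
        split_ifs with hp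
        · rw [mul_assoc, of_mul_youngSum _ (swap_mem_permsOn (mem_insert_self _ _) (hmT hp))]
          simp [hookElement]
        · have hpS : p ∈ S := by
            simp [hTdef] at hp; simp [hSdef]; omega
          have hpa : p ≠ a := by rintro rfl; exact hp haT
          have e1 : MonoidAlgebra.of ℂ _ (swap 0 a.succ) * youngSum 1 (insert 0 T') =
              youngSum 1 (insert 0 T') := by
            rw [of_mul_youngSum _ (swap_mem_permsOn (mem_insert_self _ _) (hmT haT))]
            simp
          have e2 : youngSum Perm.sign S' * MonoidAlgebra.of ℂ _ (swap p.succ a.succ) =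
              -youngSum Perm.sign S' := by
            rw [youngSum_mul_of _ (swap_mem_permsOn (hmS hpS) (hmS haS)),
              Perm.sign_swap (by simpa using hpa)]
            simp
          have e3 : (swap 0 p.succ * swap 0 a.succ : Perm (Fin (n + 1))) =
              swap p.succ a.succ * swap 0 p.succ := by
            rw [Equiv.mul_swap_eq_swap_mul, swap_apply_left, swap_apply_of_ne_of_ne
              (Fin.succ_ne_zero _) (by simpa using hpa.symm)]
          -- For p outside the arm the term is its own negative: B absorbs (0 a), which moves left
          -- past (0 p) as (p a), and A absorbs that with sign -1.
          have e4 : youngSum Perm.sign S' * MonoidAlgebra.of ℂ _ (swap 0 p.succ) *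
              youngSum 1 (insert 0 T') = -(youngSum Perm.sign S' *
                MonoidAlgebra.of ℂ _ (swap 0 p.succ) * youngSum 1 (insert 0 T')) := by
            conv_lhs => rw [← e1]
            rw [← mul_assoc, mul_assoc (youngSum _ _), ← map_mul, e3, map_mul, ← mul_assoc, e2,
              neg_mul, neg_mul]
          have e5 := add_eq_zero_iff_eq_neg.2 e4
          rw [← two_smul ℂ] at e5
          simpa using congrArg (fun x => (2⁻¹ : ℂ) • x) e5
      have hcard : (T.card : ℂ) = (n : ℂ) - r := by
        have hT2 : T.map Fin.valEmbedding = range (n - r) := by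
          ext i
          simp only [hTdef, mem_map, mem_filter, mem_univ, true_and, Fin.valEmbedding_apply,
            mem_range]
          exact ⟨by rintro ⟨j, hj, rfl⟩; omega, fun h => ⟨⟨i, by omega⟩, by simp; omega, rfl⟩⟩
        rw [← card_map Fin.valEmbedding, hT2, card_range, Nat.cast_sub hn.le]
      rw [hookElement, ← mul_assoc, ← hcomm.eq, jucysMurphy, mul_sum, sum_mul,
        sum_congr rfl fun p _ => hterm p, ← sum_filter, sum_const, filter_mem_eq_inter,
        univ_inter, ← Nat.cast_smul_eq_nsmul ℂ, hcard, hookElement]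
    rw [jmProduct_succ, mul_assoc, key, mul_smul_comm, add_mul, smul_mul_assoc, one_mul, hJ,
      ← add_smul, smul_smul, hookContent, hookContent, prod_range_succ]
    congr 2
    ring

end

/-! ### Fixed spaces of monomial matrices -/

section

/-- The vectors fixed by the monomial matrix `[π; a]`. -/
def fixSub {d n : ℕ} (π : Perm (Fin n)) (a : Fin n → rootsOfUnity d ℂ) :
    Submodule ℂ (Fin n → ℂ) where
  carrier := {v | ∀ j, v (π j) = ((a j : ℂˣ) : ℂ) * v j}
  add_mem' := by
    intro v w hv hw j
    simp only [Set.mem_ofPred_eq] at hv hw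
    rw [Pi.add_apply, hv, hw, Pi.add_apply, mul_add]
  zero_mem' := by simp
  smul_mem' := by
    intro c v hv j
    simp only [Set.mem_ofPred_eq] at hv
    rw [Pi.smul_apply, hv, Pi.smul_apply, smul_eq_mul, smul_eq_mul, mul_left_comm]

theorem mem_fixSub {d n : ℕ} {π : Perm (Fin n)} {a : Fin n → rootsOfUnity d ℂ} {v : Fin n → ℂ} :
    v ∈ fixSub π a ↔ ∀ j, v (π j) = ((a j : ℂˣ) : ℂ) * v j := Iff.rfl

theorem monomialMatrix_mulVec {d n : ℕ} (π : Perm (Fin n)) (a : Fin n → rootsOfUnity d ℂ)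
    (v : Fin n → ℂ) (j : Fin n) :
    (monomialMatrix π a).mulVec v (π j) = ((a j : ℂˣ) : ℂ) * v j := by
  rw [Matrix.mulVec, dotProduct, sum_eq_single j]
  · simp [monomialMatrix]
  · intro b _ hb
    simp [monomialMatrix, hb.symm]
  · simp

theorem fixedSpace_eq_fixSub {d n : ℕ} {g : GL (Fin n) ℂ} {π : Perm (Fin n)}
    {a : Fin n → rootsOfUnity d ℂ} (hg : (g : Matrix (Fin n) (Fin n) ℂ) = monomialMatrix π a) :
    fixedSpace g = fixSub π a := by
  ext v
  rw [fixedSpace, LinearMap.mem_eqLocus, mem_fixSub, Matrix.toLin'_apply, hg, LinearMap.id_apply,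
    funext_iff, ← π.forall_congr_right]
  simp only [monomialMatrix_mulVec]
  exact forall_congr' fun j => eq_comm

theorem fixDim_eq {d n : ℕ} {g : GL (Fin n) ℂ} {π : Perm (Fin n)}
    {a : Fin n → rootsOfUnity d ℂ} (hg : (g : Matrix (Fin n) (Fin n) ℂ) = monomialMatrix π a) :
    fixDim g = Module.finrank ℂ (fixSub π a) := by
  rw [fixDim, fixedSpace_eq_fixSub hg]

theorem fixDim_le {n : ℕ} (g : GL (Fin n) ℂ) : fixDim g ≤ n := by
  simpa [fixDim] using Submodule.finrank_le (fixedSpace g)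

theorem finrank_eq_of_tail {n : ℕ} {F : Submodule ℂ (Fin (n + 1) → ℂ)}
    {F' : Submodule ℂ (Fin n → ℂ)} (φ : F' → ℂ)
    (h : ∀ v, v ∈ F ↔ ∃ hv : Fin.tail v ∈ F', v 0 = φ ⟨Fin.tail v, hv⟩) :
    Module.finrank ℂ F = Module.finrank ℂ F' := by
  refine LinearEquiv.finrank_eq (LinearEquiv.ofBijective
    ((LinearMap.funLeft ℂ ℂ (Fin.succ : Fin n → Fin (n + 1))).restrict
      (fun v hv => ((h v).1 hv).1)) ⟨?_, ?_⟩)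
  · rintro ⟨v, hv⟩ ⟨w, hw⟩ hvw
    have ht : Fin.tail v = Fin.tail w := congrArg Subtype.val hvw
    obtain ⟨h1, h2⟩ := (h v).1 hv
    obtain ⟨h3, h4⟩ := (h w).1 hw
    ext i
    refine Fin.cases ?_ (fun j => congrFun ht j) i
    simp only [h2, h4, ht]
  · rintro ⟨w, hw⟩
    refine ⟨⟨Fin.cons (φ ⟨w, hw⟩) w, (h _).2 ⟨by simpa using hw, by simp⟩⟩, ?_⟩
    rfl

theorem finrank_eq_add_one_of_tail {n : ℕ} {F : Submodule ℂ (Fin (n + 1) → ℂ)}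
    {F' : Submodule ℂ (Fin n → ℂ)} (h : ∀ v, v ∈ F ↔ Fin.tail v ∈ F') :
    Module.finrank ℂ F = Module.finrank ℂ F' + 1 := by
  have e : F ≃ₗ[ℂ] F' × ℂ := LinearEquiv.ofBijective
    (((LinearMap.funLeft ℂ ℂ (Fin.succ : Fin n → Fin (n + 1))).restrict
      (fun v hv => (h v).1 hv)).prod ((LinearMap.proj 0).domRestrict F)) (by
    constructor
    · rintro ⟨v, hv⟩ ⟨w, hw⟩ hvw
      have ht : Fin.tail v = Fin.tail w := congrArg (fun x => (x.1 : Fin n → ℂ)) hvw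
      have h0 : v 0 = w 0 := congrArg (fun x => x.2) hvw
      ext i
      exact Fin.cases h0 (fun j => congrFun ht j) i
    · rintro ⟨⟨w, hw⟩, z⟩
      refine ⟨⟨Fin.cons z w, (h _).2 (by simpa using hw)⟩, ?_⟩
      refine Prod.ext (Subtype.ext ?_) ?_
      · rfl
      · rfl)
  rw [e.finrank_eq, Module.finrank_prod, Module.finrank_self]

/-! ### Fixed spaces after removing coordinate 0 -/

section Recursion

variable {d n : ℕ} (e : Perm (Fin n)) (a : Fin n → rootsOfUnity d ℂ)

theorem finrank_fixSub_cons_one :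
    Module.finrank ℂ (fixSub (Perm.decomposeFin.symm (0, e)) (Fin.cons 1 a : Fin (n + 1) → _)) =
      Module.finrank ℂ (fixSub e a) + 1 := by
  refine finrank_eq_add_one_of_tail fun v => ?_
  simp [mem_fixSub, Fin.forall_fin_succ, Fin.tail]

theorem finrank_fixSub_cons_ne_one {ζ : rootsOfUnity d ℂ} (hζ : ζ ≠ 1) :
    Module.finrank ℂ (fixSub (Perm.decomposeFin.symm (0, e)) (Fin.cons ζ a : Fin (n + 1) → _)) =
      Module.finrank ℂ (fixSub e a) := by
  refine finrank_eq_of_tail (fun _ => 0) fun v => ?_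
  have h1 : ((ζ : ℂˣ) : ℂ) ≠ 1 := by simpa using hζ
  have h2 : v 0 = ((ζ : ℂˣ) : ℂ) * v 0 ↔ v 0 = 0 := by
    constructor
    · intro h
      have : (((ζ : ℂˣ) : ℂ) - 1) * v 0 = 0 := by rw [sub_mul, one_mul, ← h, sub_self]
      exact (mul_eq_zero.1 this).resolve_left (sub_ne_zero.2 h1)
    · intro h; simp [h]
  simp [mem_fixSub, Fin.forall_fin_succ, Fin.tail, h2, and_comm]

/-- Column 0 forces v_0 = ζ⁻¹ v_{j+1}. Eliminating v_0 from the column that e sent to j, now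
rerouted to row 0, multiplies the entry of that column by ζ. -/
theorem finrank_fixSub_cons_succ (ζ : rootsOfUnity d ℂ) (j : Fin n) :
    Module.finrank ℂ (fixSub (Perm.decomposeFin.symm (j.succ, e))
        (Fin.cons ζ a : Fin (n + 1) → _)) =
      Module.finrank ℂ (fixSub e (a * Pi.mulSingle (e⁻¹ j) ζ)) := by
  refine finrank_eq_of_tail (fun v => (((ζ : ℂˣ)⁻¹ : ℂˣ) : ℂ) * v.1 j) fun v => ?_
  have hz : ((ζ : ℂˣ) : ℂ) ≠ 0 := Units.ne_zero _
  simp only [mem_fixSub, Fin.forall_fin_succ, Perm.decomposeFin_symm_apply_zero, Fin.cons_zero,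
    Perm.decomposeFin_symm_apply_succ, Fin.cons_succ, Fin.tail, Pi.mul_apply, exists_prop]
  have h0 : v j.succ = ((ζ : ℂˣ) : ℂ) * v 0 ↔ v 0 = (((ζ : ℂˣ)⁻¹ : ℂˣ) : ℂ) * v j.succ := by
    rw [Units.val_inv_eq_inv_val, eq_inv_mul_iff_mul_eq₀ hz, eq_comm]
  rw [h0, and_comm]
  refine and_congr_left fun hv0 => forall_congr' fun i => ?_
  by_cases hi : e i = j
  · have hi' : i = e⁻¹ j := by rw [← hi]; simp
    rw [hi, swap_apply_right, hi', Pi.mulSingle_eq_same, hv0, Units.val_inv_eq_inv_val,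
      inv_mul_eq_iff_eq_mul₀ hz, Subgroup.coe_mul, Units.val_mul]
    ring_nf
  · have hi' : i ≠ e⁻¹ j := by rintro rfl; simp at hi
    rw [swap_apply_of_ne_of_ne (Fin.succ_ne_zero _) (by simpa using hi),
      Pi.mulSingle_eq_of_ne hi', mul_one]

end Recursion

/-! ### Character-twisted sums and the Jucys–Murphy product -/

instance fintypeRootsOfUnity {d : ℕ} [NeZero d] : Fintype (rootsOfUnity d ℂ) := Fintype.ofFinite _

/-- The coefficient of `π` in the image of `∑ x ^ fixDim u • u` under the homomorphism
`[π; a] ↦ χ (∏ a) • π`. -/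
def twistedSum {d : ℕ} [NeZero d] (χ : rootsOfUnity d ℂ →* ℂ) (x : ℂ) {n : ℕ} (π : Perm (Fin n)) :
    ℂ :=
  ∑ a : Fin n → rootsOfUnity d ℂ, χ (∏ i, a i) * x ^ Module.finrank ℂ (fixSub π a)

variable {d : ℕ} [NeZero d] (χ : rootsOfUnity d ℂ →* ℂ) (x : ℂ)

theorem sum_fin_succ_rootsOfUnity {n : ℕ} (f : (Fin (n + 1) → rootsOfUnity d ℂ) → ℂ) :
    ∑ a, f a = ∑ ζ, ∑ a : Fin n → rootsOfUnity d ℂ, f (Fin.cons ζ a) := by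
  rw [← Fintype.sum_prod_type', ← (Fin.consEquiv fun _ => rootsOfUnity d ℂ).sum_comp]
  rfl

/-- The fixed point 0 contributes x when its entry is 1 and χ(ζ) when its entry is ζ ≠ 1. -/
theorem twistedSum_zero {n : ℕ} (e : Perm (Fin n)) :
    twistedSum χ x (Perm.decomposeFin.symm (0, e)) = (x - 1 + ∑ ζ, χ ζ) * twistedSum χ x e := by
  classical
  have h : ∀ ζ : rootsOfUnity d ℂ, ∑ a : Fin n → rootsOfUnity d ℂ,
      χ (∏ i, (Fin.cons ζ a : Fin (n + 1) → _) i) * x ^ Module.finrank ℂ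
        (fixSub (Perm.decomposeFin.symm (0, e)) (Fin.cons ζ a : Fin (n + 1) → _)) =
      (χ ζ + if ζ = 1 then x - 1 else 0) * twistedSum χ x e := by
    intro ζ
    rw [twistedSum, mul_sum]
    refine sum_congr rfl fun a _ => ?_
    simp only [Fin.prod_univ_succ, Fin.cons_zero, Fin.cons_succ, map_mul]
    split_ifs with hζ
    · subst hζ
      rw [finrank_fixSub_cons_one, map_one]
      ring
    · rw [finrank_fixSub_cons_ne_one e a hζ]
      ring
  rw [twistedSum, sum_fin_succ_rootsOfUnity, sum_congr rfl fun ζ _ => h ζ, ← sum_mul,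
    sum_add_distrib, sum_ite_eq', if_pos (mem_univ _), add_comm]

theorem card_rootsOfUnity_complex : Fintype.card (rootsOfUnity d ℂ) = d := by
  rw [← Nat.card_eq_fintype_card, Complex.card_rootsOfUnity]

/-- The entry ζ is absorbed into a neighbouring column without changing the total product, so all d
choices of ζ give the same sum. -/
theorem twistedSum_succ {n : ℕ} (e : Perm (Fin n)) (j : Fin n) :
    twistedSum χ x (Perm.decomposeFin.symm (j.succ, e)) = d * twistedSum χ x e := by
  have h : ∀ ζ : rootsOfUnity d ℂ, ∑ a : Fin n → rootsOfUnity d ℂ,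
      χ (∏ i, (Fin.cons ζ a : Fin (n + 1) → _) i) * x ^ Module.finrank ℂ
        (fixSub (Perm.decomposeFin.symm (j.succ, e)) (Fin.cons ζ a : Fin (n + 1) → _)) =
      twistedSum χ x e := by
    intro ζ
    rw [twistedSum]
    refine Fintype.sum_equiv (Equiv.mulRight (Pi.mulSingle (e⁻¹ j) ζ)) _ _ fun a => ?_
    rw [finrank_fixSub_cons_succ]
    rw [Fin.prod_univ_succ]
    simp only [Fin.cons_zero, Fin.cons_succ, Equiv.coe_mulRight, Pi.mul_apply, prod_mul_distrib]
    rw [Finset.prod_pi_mulSingle' (e⁻¹ j) ζ univ, if_pos (mem_univ _), mul_comm ζ]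
    rfl
  rw [twistedSum, sum_fin_succ_rootsOfUnity, sum_congr rfl fun ζ _ => h ζ, sum_const, card_univ,
    card_rootsOfUnity_complex, nsmul_eq_mul]

theorem coeff_of {G : Type*} [Monoid G] [DecidableEq G] (g h : G) :
    (MonoidAlgebra.of ℂ G g).coeff h = if g = h then 1 else 0 := by
  rw [MonoidAlgebra.of_apply, MonoidAlgebra.coeff_single, Finsupp.single_apply]

/-- Expanding (y + J) · f runs over the products (0 p) f, and each permutation of n + 1 points has
exactly one such form. -/
theorem coeff_jmProduct_succ (y : ℂ) {n : ℕ} (p : Fin (n + 1)) (e : Perm (Fin n)) :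
    (jmProduct y (n + 1)).coeff (Perm.decomposeFin.symm (p, e)) =
      (if p = 0 then y else 1) * (jmProduct y n).coeff e := by
  rw [jmProduct_succ]
  generalize jmProduct y n = z
  induction z using MonoidAlgebra.induction_on with
  | add z w hz hw =>
    rw [map_add, mul_add, MonoidAlgebra.coeff_add, Finsupp.add_apply, hz, hw,
      MonoidAlgebra.coeff_add, Finsupp.add_apply, mul_add]
  | smul c z hz =>
    rw [map_smul, mul_smul_comm, MonoidAlgebra.coeff_smul_apply, hz,
      MonoidAlgebra.coeff_smul_apply, smul_eq_mul, smul_eq_mul, mul_left_comm]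
  | of f =>
    have h : (y • 1 + jucysMurphy n) * liftAlg n (MonoidAlgebra.of ℂ _ f) =
        ∑ q : Fin (n + 1), (if q = 0 then y else 1) •
          MonoidAlgebra.of ℂ _ (Perm.decomposeFin.symm (q, f)) := by
      rw [Fin.sum_univ_succ, liftAlg_of, add_mul, jucysMurphy, sum_mul, smul_mul_assoc, one_mul]
      simp only [decomposeFin_symm_eq, map_mul, Fin.succ_ne_zero, if_true, if_false, one_smul,
        swap_self, ← Perm.one_def, one_mul]
    rw [h, MonoidAlgebra.coeff_sum, Finsupp.finsetSum_apply, sum_eq_single p]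
    · rw [MonoidAlgebra.coeff_smul_apply, smul_eq_mul, coeff_of, coeff_of]
      simp
    · intro q _ hq
      rw [MonoidAlgebra.coeff_smul_apply, smul_eq_mul, coeff_of]
      simp [hq]
    · simp

/-- Both sides obey the same recursion along `decomposeFin`: a factor d y when 0 is fixed and d
otherwise. -/
theorem twistedSum_eq (y : ℂ) (hy : d * y = x - 1 + ∑ ζ, χ ζ) {n : ℕ} (π : Perm (Fin n)) :
    twistedSum χ x π = d ^ n * (jmProduct y n).coeff π := by
  induction n with
  | zero =>
    have : π = 1 := Subsingleton.elim _ _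
    subst this
    have h0 : Module.finrank ℂ (fixSub (1 : Perm (Fin 0))
        (default : Fin 0 → rootsOfUnity d ℂ)) = 0 := Module.finrank_zero_of_subsingleton
    simp [twistedSum, jmProduct, h0]
  | succ n ih =>
    obtain ⟨⟨p, e⟩, rfl⟩ := Perm.decomposeFin.symm.surjective π
    rw [coeff_jmProduct_succ]
    refine Fin.cases ?_ (fun j => ?_) p
    · rw [twistedSum_zero, ih, ← hy]
      simp
      ring
    · rw [twistedSum_succ, ih]
      simp
      ring

end

/-! ### Centrality of the Jucys–Murphy product -/

section

theorem commute_of_coeff_conj {G : Type*} [Group G] (x : MonoidAlgebra ℂ G)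
    (h : ∀ g u : G, x.coeff (g * u * g⁻¹) = x.coeff u) (g : G) :
    Commute (MonoidAlgebra.of ℂ G g) x := by
  rw [commute_iff_eq]
  ext u
  rw [MonoidAlgebra.of_apply, MonoidAlgebra.coeff_single_mul_apply,
    MonoidAlgebra.coeff_mul_single_apply, one_mul, mul_one, ← h g (g⁻¹ * u)]
  congr 1
  group

theorem coeff_conj_of_commute {G : Type*} [Group G] {x : MonoidAlgebra ℂ G}
    (h : ∀ g, Commute (MonoidAlgebra.of ℂ G g) x) (g u : G) :
    x.coeff (g * u * g⁻¹) = x.coeff u := by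
  have h1 := congrArg (fun z => z.coeff (g * u)) (h g).eq
  simp only [MonoidAlgebra.of_apply, MonoidAlgebra.coeff_single_mul_apply,
    MonoidAlgebra.coeff_mul_single_apply, one_mul, mul_one] at h1
  rw [← h1]
  congr 1
  group

theorem finrank_fixSub_conj {n : ℕ} (g π : Perm (Fin n)) :
    Module.finrank ℂ (fixSub (g * π * g⁻¹) (1 : Fin n → rootsOfUnity 1 ℂ)) =
      Module.finrank ℂ (fixSub π (1 : Fin n → rootsOfUnity 1 ℂ)) := by
  have : fixSub (g * π * g⁻¹) (1 : Fin n → rootsOfUnity 1 ℂ) =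
      (fixSub π (1 : Fin n → rootsOfUnity 1 ℂ)).comap
        (LinearEquiv.funCongrLeft ℂ ℂ g : (Fin n → ℂ) →ₗ[ℂ] (Fin n → ℂ)) := by
    ext v
    rw [Submodule.mem_comap, mem_fixSub, mem_fixSub, ← g.forall_congr_right]
    simp [LinearEquiv.funCongrLeft_apply, LinearMap.funLeft_apply]
  rw [this]
  exact LinearEquiv.finrank_eq (LinearEquiv.ofSubmodule' _ _)

/-- The case d = 1 of `twistedSum_eq`, where the twisted sum has a single term. It exhibits the
coefficients as a class function, whence centrality. -/
theorem coeff_jmProduct (y : ℂ) {n : ℕ} (π : Perm (Fin n)) :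
    (jmProduct y n).coeff π =
      y ^ Module.finrank ℂ (fixSub π (1 : Fin n → rootsOfUnity 1 ℂ)) := by
  have : Subsingleton (rootsOfUnity 1 ℂ) :=
    Fintype.card_le_one_iff_subsingleton.1 (card_rootsOfUnity_complex (d := 1)).le
  have h := twistedSum_eq (d := 1) 1 y y (by simp) π
  rw [twistedSum, Fintype.sum_subsingleton _ (1 : Fin n → rootsOfUnity 1 ℂ)] at h
  simpa using h.symm

theorem commute_jmProduct (y : ℂ) {n : ℕ} (g : Perm (Fin n)) :
    Commute (MonoidAlgebra.of ℂ _ g) (jmProduct y n) := by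
  refine commute_of_coeff_conj _ (fun g u => ?_) g
  rw [coeff_jmProduct, coeff_jmProduct, finrank_fixSub_conj]

theorem exists_perm_map {n r : ℕ} (hr : r < n) (S : Finset (Fin n)) (a : Fin n) (ha : a ∈ S)
    (hS : S.card = r + 1) :
    ∃ g : Perm (Fin n), (univ.filter fun i : Fin n => n ≤ (i : ℕ) + r + 1).map g.toEmbedding = S ∧
      (univ.filter fun i : Fin n => (i : ℕ) + r + 1 ≤ n).map g.toEmbedding = insert a Sᶜ := by
  set S₀ := univ.filter fun i : Fin n => n ≤ (i : ℕ) + r + 1 with hS₀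
  have hcard : S₀.card = r + 1 := by
    have hT2 : S₀.map Fin.valEmbedding = Ico (n - r - 1) n := by
      ext i
      simp only [hS₀, mem_map, mem_filter, mem_univ, true_and, Fin.valEmbedding_apply, mem_Ico]
      exact ⟨by rintro ⟨j, hj, rfl⟩; omega, fun h => ⟨⟨i, by omega⟩, by simp; omega, rfl⟩⟩
    rw [← card_map Fin.valEmbedding, hT2, Nat.card_Ico]
    omega
  obtain ⟨e⟩ : Nonempty ({x // x ∈ S₀} ≃ {x // x ∈ S}) :=
    ⟨Finset.equivOfCardEq (by rw [hcard, hS])⟩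
  let a₀ : Fin n := ⟨n - r - 1, by omega⟩
  have ha₀ : a₀ ∈ S₀ := by simp [hS₀, a₀]; omega
  let h := e.extendSubtype
  have hh : ∀ x, h x ∈ S ↔ x ∈ S₀ := fun x =>
    ⟨fun hx => by_contra fun hn => e.extendSubtype_not_mem x hn hx, fun hx => e.extendSubtype_mem x hx⟩
  have hs : ∀ x, swap (h a₀) a x ∈ S ↔ x ∈ S := fun x =>
    permsOn_apply_mem (swap_mem_permsOn ((hh _).2 ha₀) ha)
  -- The extension h matches the sets but may misplace the corner; a swap inside S repairs this.
  let g := swap (h a₀) a * h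
  have hg : ∀ x, g x ∈ S ↔ x ∈ S₀ := fun x => (hs _).trans (hh x)
  have hga : ∀ x, g x = a ↔ x = a₀ := by
    intro x
    rw [← show g a₀ = a by simp [g]]
    exact g.injective.eq_iff
  refine ⟨g, ?_, ?_⟩
  · ext x
    obtain ⟨x, rfl⟩ := g.surjective x
    rw [hg]
    simp
  · ext x
    obtain ⟨x, rfl⟩ := g.surjective x
    rw [mem_insert, mem_compl, hg, hga]
    simp [hS₀, a₀, Fin.ext_iff]
    omega

/-- Conjugation carries the standard hook element to any other of the same shape, and centrality
preserves the eigenvalue. -/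
theorem jmProduct_mul_hookElement (y : ℂ) {n r : ℕ} (hr : r < n) (S : Finset (Fin n)) (a : Fin n)
    (ha : a ∈ S) (hS : S.card = r + 1) :
    jmProduct y n * hookElement S (insert a Sᶜ) =
      hookContent n r y • hookElement S (insert a Sᶜ) := by
  obtain ⟨g, h1, h2⟩ := exists_perm_map hr S a ha hS
  rw [← h2, ← h1, ← conj_hookElement, ← mul_assoc, ← mul_assoc, ← (commute_jmProduct y g).eq,
    mul_assoc (MonoidAlgebra.of ℂ _ g), jmProduct_mul_hookElement_std y r n hr, mul_smul_comm,
    smul_mul_assoc]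

theorem commute_list_prod_jmProduct {n : ℕ} (ys : List ℂ) (g : Perm (Fin n)) :
    Commute (MonoidAlgebra.of ℂ _ g) (ys.map fun y => jmProduct y n).prod :=
  Commute.list_prod_right _ _ (by simp; exact fun y _ => commute_jmProduct y g)

theorem list_prod_mul_hookElement (ys : List ℂ) {n r : ℕ} (hr : r < n) (S : Finset (Fin n))
    (a : Fin n) (ha : a ∈ S) (hS : S.card = r + 1) :
    (ys.map fun y => jmProduct y n).prod * hookElement S (insert a Sᶜ) =
      (ys.map (hookContent n r)).prod • hookElement S (insert a Sᶜ) := by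
  induction ys with
  | nil => simp
  | cons y ys ih =>
    rw [List.map_cons, List.prod_cons, mul_assoc, ih, mul_smul_comm,
      jmProduct_mul_hookElement y hr S a ha hS, smul_smul, List.map_cons, List.prod_cons, mul_comm]

/-- If σ τ = 1 with σ on S and τ on T, then σ is supported on S ∩ T, which is too small for a
nontrivial permutation. -/
theorem coeff_hookElement_one {α : Type*} [Fintype α] [DecidableEq α] (S T : Finset α)
    (h : (S ∩ T).card ≤ 1) : (hookElement S T).coeff 1 = 1 := by
  rw [hookElement, youngSum, youngSum, sum_mul_sum, MonoidAlgebra.coeff_sum,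
    Finsupp.finsetSum_apply, sum_eq_single 1]
  · rw [MonoidAlgebra.coeff_sum, Finsupp.finsetSum_apply, sum_eq_single 1]
    · rw [smul_mul_smul_comm, ← map_mul, MonoidAlgebra.coeff_smul_apply, coeff_of]
      simp
    · intro τ _ hτ
      rw [smul_mul_smul_comm, ← map_mul, MonoidAlgebra.coeff_smul_apply, coeff_of]
      simp [hτ]
    · simp [mem_permsOn]
  · intro σ hσ hσ1
    rw [MonoidAlgebra.coeff_sum, Finsupp.finsetSum_apply]
    refine sum_eq_zero fun τ hτ => ?_
    rw [smul_mul_smul_comm, ← map_mul, MonoidAlgebra.coeff_smul_apply, coeff_of, if_neg, smul_zero]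
    intro hst
    apply hσ1
    have hσT : σ ∈ permsOn T := by
      rw [eq_inv_of_mul_eq_one_left hst]; exact permsOn_inv hτ
    by_contra hne
    have hsup : σ.support ⊆ S ∩ T := by
      intro i hi
      rw [Perm.mem_support] at hi
      rw [mem_inter]
      exact ⟨by_contra fun h' => hi (mem_permsOn.1 hσ i h'),
        by_contra fun h' => hi (mem_permsOn.1 hσT i h')⟩
    have := Perm.two_le_card_support_of_ne_one hne
    have := card_le_card hsup
    omega
  · simp [mem_permsOn]

end

/-! ### Hook elements and orbits -/

section

section Orbits

variable {α : Type*} [Fintype α] [DecidableEq α]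

theorem coeff_hookElement_compl_mul {S : Finset α} {σ τ : Perm α} (hσ : σ ∈ permsOn S)
    (hτ : τ ∈ permsOn Sᶜ) :
    (hookElement S Sᶜ).coeff (σ * τ) = (((Perm.sign σ : ℤˣ) : ℤ) : ℂ) := by
  have h : MonoidAlgebra.of ℂ _ σ⁻¹ * hookElement S Sᶜ * MonoidAlgebra.of ℂ _ τ⁻¹ =
      (((Perm.sign σ : ℤˣ) : ℤ) : ℂ) • hookElement S Sᶜ := by
    rw [hookElement, ← mul_assoc, of_mul_youngSum _ (permsOn_inv hσ), mul_assoc,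
      youngSum_mul_of _ (permsOn_inv hτ)]
    simp
  have h1 := congrArg (fun z => z.coeff 1) h
  simp only [MonoidAlgebra.of_apply, MonoidAlgebra.coeff_single_mul_apply,
    MonoidAlgebra.coeff_mul_single_apply, one_mul, mul_one, MonoidAlgebra.coeff_smul_apply,
    coeff_hookElement_one S Sᶜ (by simp), inv_inv, smul_eq_mul] at h1
  exact h1

theorem coeff_hookElement_compl_eq_zero {S : Finset α} {π : Perm α}
    (h : ¬∀ i, π i ∈ S ↔ i ∈ S) : (hookElement S Sᶜ).coeff π = 0 := by
  rw [hookElement, youngSum, youngSum, sum_mul_sum, MonoidAlgebra.coeff_sum,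
    Finsupp.finsetSum_apply]
  refine sum_eq_zero fun σ hσ => ?_
  rw [MonoidAlgebra.coeff_sum, Finsupp.finsetSum_apply]
  refine sum_eq_zero fun τ hτ => ?_
  rw [smul_mul_smul_comm, ← map_mul, MonoidAlgebra.coeff_smul_apply, coeff_of, if_neg, smul_zero]
  rintro rfl
  refine h fun i => ?_
  rw [Perm.mul_apply, permsOn_apply_mem hσ, ← not_iff_not, ← mem_compl, ← mem_compl,
    permsOn_apply_mem hτ]

theorem exists_mul_of_invariant {S : Finset α} {π : Perm α} (h : ∀ i, π i ∈ S ↔ i ∈ S) :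
    ∃ σ ∈ permsOn S, ∃ τ ∈ permsOn Sᶜ, π = σ * τ := by
  set σ : Perm α := Perm.ofSubtype (π.subtypePerm h) with hσ
  have h1 : ∀ i, i ∈ S → σ i = π i := fun i hi => Perm.ofSubtype_subtypePerm_of_mem h hi
  refine ⟨σ, ?_, σ⁻¹ * π, ?_, by simp⟩
  · rw [mem_permsOn]
    exact fun i hi => Perm.ofSubtype_subtypePerm_of_not_mem h hi
  · rw [mem_permsOn]
    intro i hi
    rw [mem_compl, not_not] at hi
    rw [Perm.mul_apply, ← h1 i hi]
    simp

/-- The orbit of `x` under `π`. -/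
def orbitFinset (π : Perm α) (x : α) : Finset α := univ.filter fun y => π.SameCycle x y

theorem mem_orbitFinset {π : Perm α} {x y : α} : y ∈ orbitFinset π x ↔ π.SameCycle x y := by
  simp [orbitFinset]

theorem mem_of_sameCycle {β : Type*} [Fintype β] {S : Finset β} {π : Perm β} (h : ∀ i, π i ∈ S ↔ i ∈ S) {x y : β}
    (hxy : π.SameCycle x y) : y ∈ S ↔ x ∈ S := by
  obtain ⟨k, -, rfl⟩ := hxy.exists_pow_eq'
  induction k with
  | zero => simp
  | succ k ih => rw [pow_succ', Perm.mul_apply, h, ih ⟨k, rfl⟩]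

theorem sign_cycleOf (π : Perm α) (x : α) :
    Perm.sign (π.cycleOf x) = -(-1) ^ (orbitFinset π x).card := by
  by_cases hx : π x = x
  · have h1 : π.cycleOf x = 1 := Perm.cycleOf_eq_one_iff π |>.2 hx
    have h2 : orbitFinset π x = {x} := by
      ext y
      rw [mem_orbitFinset, mem_singleton]
      constructor
      · intro h
        exact (h.eq_of_left hx).symm
      · rintro rfl; exact Perm.SameCycle.refl _ _
    rw [h1, h2]
    simp
  · have h2 : orbitFinset π x = (π.cycleOf x).support := by
      ext y
      rw [mem_orbitFinset, Perm.mem_support_cycleOf_iff' hx]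
    rw [h2, (Perm.isCycle_cycleOf π hx).sign]

/-- Moving the cycle through x to the antisymmetrized side multiplies the sign by -(-1)^ℓ, with ℓ
the orbit size, while (-1)^|S| gains (-1)^ℓ. -/
theorem coeff_hookElement_union_orbit {S : Finset α} {π : Perm α} (h : ∀ i, π i ∈ S ↔ i ∈ S)
    {x : α} (hx : x ∉ S) :
    (-1 : ℂ) ^ (S ∪ orbitFinset π x).card *
        (hookElement (S ∪ orbitFinset π x) (S ∪ orbitFinset π x)ᶜ).coeff π =
      -((-1 : ℂ) ^ S.card * (hookElement S Sᶜ).coeff π) := by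
  have hdisj : ∀ i, i ∈ S → ¬π.SameCycle x i := fun i hi hc => hx ((mem_of_sameCycle h hc).1 hi)
  obtain ⟨σ, hσ, τ, hτ, rfl⟩ := exists_mul_of_invariant h
  set π := σ * τ with hπ
  have e1 : π = (σ * π.cycleOf x) * ((π.cycleOf x)⁻¹ * τ) := by rw [hπ]; group
  have h1 : σ * π.cycleOf x ∈ permsOn (S ∪ orbitFinset π x) := by
    rw [mem_permsOn] at *
    intro i hi
    rw [mem_union, not_or, mem_orbitFinset] at hi
    rw [Perm.mul_apply, Perm.cycleOf_apply_of_not_sameCycle hi.2, hσ i hi.1]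
  have h2 : (π.cycleOf x)⁻¹ * τ ∈ permsOn (S ∪ orbitFinset π x)ᶜ := by
    have hτ' := mem_permsOn.1 hτ
    rw [mem_permsOn]
    intro i hi
    rw [mem_compl, not_not, mem_union, mem_orbitFinset] at hi
    rw [Perm.mul_apply, Perm.inv_eq_iff_eq]
    rcases hi with hi | hi
    · rw [hτ' i (by simpa using hi), Perm.cycleOf_apply_of_not_sameCycle (hdisj i hi)]
    · rw [hi.cycleOf_apply, hπ, Perm.mul_apply]
      have hiS : i ∉ S := fun hc => hdisj i hc hi
      have : τ i ∉ S := by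
        rw [← mem_compl, permsOn_apply_mem hτ, mem_compl]; exact hiS
      exact (mem_permsOn.1 hσ _ this).symm
  have hc : (S ∪ orbitFinset π x).card = S.card + (orbitFinset π x).card := by
    refine card_union_of_disjoint (disjoint_left.2 fun i hi hc => hdisj i hi (mem_orbitFinset.1 hc))
  have h3 : (hookElement S Sᶜ).coeff π = _ := coeff_hookElement_compl_mul hσ hτ
  have h4 := coeff_hookElement_compl_mul h1 h2
  rw [← e1] at h4
  rw [h3, h4, hc, Perm.sign_mul, sign_cycleOf]
  push_cast
  have : ((-1 : ℂ) ^ (orbitFinset π x).card) * ((-1 : ℂ) ^ (orbitFinset π x).card) = 1 := by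
    rw [← mul_pow]; simp
  rw [pow_add]
  linear_combination (-(-1 : ℂ) ^ S.card * (((Perm.sign σ : ℤˣ) : ℤ) : ℂ)) * this

/-- Only π-invariant S contribute. If some orbit misses i, toggling that orbit in S is a
sign-reversing involution; otherwise only S = ∅ survives. -/
theorem sum_coeff_hookElement (π : Perm α) (i : α) [Decidable (∀ x, π.SameCycle i x)] :
    ∑ S ∈ univ.filter (fun S : Finset α => i ∉ S), (-1 : ℂ) ^ S.card *
      (hookElement S Sᶜ).coeff π = if ∀ x, π.SameCycle i x then 1 else 0 := by
  split_ifs with htrans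
  · rw [sum_eq_single ∅]
    · have := coeff_hookElement_compl_mul (S := ∅) (σ := 1) (τ := π) (by simp [mem_permsOn])
        (by simp [mem_permsOn])
      rw [one_mul] at this
      rw [this]
      simp
    · intro S hS hne
      rw [coeff_hookElement_compl_eq_zero, mul_zero]
      intro h
      obtain ⟨x, hx⟩ := nonempty_iff_ne_empty.2 hne
      exact (mem_filter.1 hS).2 ((mem_of_sameCycle h (htrans x)).1 hx)
    · simp
  · obtain ⟨x, hx⟩ := not_forall.1 htrans
    have hiA : i ∉ orbitFinset π x := fun h => hx (mem_orbitFinset.1 h).symm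
    have hA : ∀ j, π j ∈ orbitFinset π x ↔ j ∈ orbitFinset π x := fun j => by
      rw [mem_orbitFinset, mem_orbitFinset, Perm.sameCycle_apply_right]
    have hxA : x ∈ orbitFinset π x := mem_orbitFinset.2 (Perm.SameCycle.refl _ _)
    refine sum_involution (fun S _ => symmDiff S (orbitFinset π x)) ?_ ?_ ?_ ?_
    · intro S hS
      by_cases h : ∀ j, π j ∈ S ↔ j ∈ S
      · by_cases hxS : x ∈ S
        · have hsub : orbitFinset π x ⊆ S := fun y hy =>
            (mem_of_sameCycle h (mem_orbitFinset.1 hy)).2 hxS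
          have h' : ∀ j, π j ∈ S \ orbitFinset π x ↔ j ∈ S \ orbitFinset π x := fun j => by
            rw [mem_sdiff, mem_sdiff, h, hA]
          have := coeff_hookElement_union_orbit h' (x := x) (by simp [hxA])
          rw [sdiff_union_of_subset hsub] at this
          rw [symmDiff_of_ge hsub, this]
          ring
        · have hdis : Disjoint S (orbitFinset π x) := disjoint_left.2 fun y hy hc =>
            hxS ((mem_of_sameCycle h (mem_orbitFinset.1 hc)).1 hy)
          rw [hdis.symmDiff_eq_sup, sup_eq_union, coeff_hookElement_union_orbit h hxS]
          ring
      · have h' : ¬∀ j, π j ∈ symmDiff S (orbitFinset π x) ↔ j ∈ symmDiff S (orbitFinset π x) := by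
          intro h'
          refine h fun j => ?_
          have h1 := h' j
          have h2 := hA j
          simp only [mem_symmDiff] at h1
          tauto
        rw [coeff_hookElement_compl_eq_zero h, coeff_hookElement_compl_eq_zero h']
        simp
    · intro S _ _ he
      have : x ∈ symmDiff S (orbitFinset π x) ↔ x ∈ S := by rw [he]
      rw [mem_symmDiff] at this
      tauto
    · intro S hS
      simp only [mem_filter, mem_univ, true_and, mem_symmDiff] at *
      tauto
    · intro S _
      exact symmDiff_symmDiff_cancel_right _ _

end Orbits

end

/-! ### Factorizations of a long cycle -/

section

/-- All points lie in a single orbit of `π`. -/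
def IsTransitive {n : ℕ} (π : Perm (Fin n)) : Prop := ∀ x y, π.SameCycle x y

theorem IsTransitive.inv {n : ℕ} {π : Perm (Fin n)} (h : IsTransitive π) : IsTransitive π⁻¹ :=
  fun x y => Perm.sameCycle_inv.2 (h x y)

theorem IsTransitive.isConj {n : ℕ} {π σ : Perm (Fin n)} (hπ : IsTransitive π)
    (hσ : IsTransitive σ) : IsConj π σ := by
  rcases Nat.lt_or_ge 1 n with hn | hn
  · have key : ∀ {τ : Perm (Fin n)}, IsTransitive τ → τ.IsCycle ∧ τ.support = univ := by
      intro τ hτ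
      have hne : ∀ x, τ x ≠ x := by
        intro x hx
        obtain ⟨y, hy⟩ : ∃ y : Fin n, x ≠ y := by
          have : Nontrivial (Fin n) := Fin.nontrivial_iff_two_le.2 hn
          obtain ⟨y, hy⟩ := exists_ne x
          exact ⟨y, hy.symm⟩
        exact hy ((hτ x y).eq_of_left hx)
      exact ⟨⟨⟨0, by omega⟩, hne _, fun y _ => hτ _ y⟩, by ext x; simp [hne]⟩
    exact (key hπ).1.isConj (key hσ).1 (by rw [(key hπ).2, (key hσ).2])
  · have : Subsingleton (Fin n) := Fin.subsingleton_iff_le_one.2 hn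
    rw [Subsingleton.elim π σ]

/-- The splitting gives n - |S| hooks of leg |S| and |S| hooks of leg |S| - 1, each with coefficient
1 at the identity. For S = ∅ the truncated |S| - 1 is multiplied by zero. -/
theorem card_mul_coeff_hookElement_compl (ys : List ℂ) {n : ℕ} (S : Finset (Fin n)) :
    (n : ℂ) * ((ys.map fun y => jmProduct y n).prod * hookElement S Sᶜ).coeff 1 =
      ((n - S.card : ℕ) : ℂ) * (ys.map (hookContent n S.card)).prod +
        (S.card : ℂ) * (ys.map (hookContent n (S.card - 1))).prod := by
  set P := (ys.map fun y => jmProduct y n).prod with hP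
  have h0 : (n : ℂ) * (P * hookElement S Sᶜ).coeff 1 =
      (P * ((Fintype.card (Fin n) : ℂ) • hookElement S Sᶜ)).coeff 1 := by
    rw [mul_smul_comm, MonoidAlgebra.coeff_smul_apply, smul_eq_mul, Fintype.card_fin]
  rw [h0, card_smul_hookElement_compl, mul_add, MonoidAlgebra.coeff_add, Finsupp.add_apply,
    mul_sum, mul_sum, MonoidAlgebra.coeff_sum, MonoidAlgebra.coeff_sum, Finsupp.finsetSum_apply,
    Finsupp.finsetSum_apply]
  have key : ∀ (T : Finset (Fin n)) (a : Fin n), a ∈ T →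
      (P * hookElement T (insert a Tᶜ)).coeff 1 = (ys.map (hookContent n (T.card - 1))).prod := by
    intro T a ha
    have hpos := card_pos.2 ⟨a, ha⟩
    have hle := card_le_univ T
    rw [Fintype.card_fin] at hle
    rw [hP, list_prod_mul_hookElement ys (r := T.card - 1) (by omega) T a ha (by omega),
      MonoidAlgebra.coeff_smul_apply, coeff_hookElement_one, smul_eq_mul, mul_one]
    rw [inter_insert_of_mem ha]
    simp
  congr 1
  · have : ∀ b ∈ Sᶜ, (P * hookElement (insert b S) Sᶜ).coeff 1 =
        (ys.map (hookContent n S.card)).prod := by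
      intro b hb
      have hbS : b ∉ S := mem_compl.1 hb
      have h1 := key (insert b S) b (mem_insert_self _ _)
      rw [card_insert_of_notMem hbS, Nat.add_sub_cancel] at h1
      rw [← h1]
      have hset : insert b (insert b S)ᶜ = Sᶜ := by
        ext x
        by_cases hx : x = b <;> simp [hx, hbS]
      rw [hset]
    rw [sum_congr rfl this, sum_const, card_compl, Fintype.card_fin, nsmul_eq_mul]
  · rw [sum_congr rfl fun a ha => key S a ha, sum_const, nsmul_eq_mul]

theorem coeff_mul_one {G : Type*} [Group G] [Fintype G] (x y : MonoidAlgebra ℂ G) :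
    (x * y).coeff 1 = ∑ g, x.coeff g⁻¹ * y.coeff g := by
  rw [MonoidAlgebra.coeff_mul_apply_right, Finsupp.sum_fintype _ _ (by simp)]
  simp

/-- After C(m+1,j)(m+1-j) = (m+1) C(m,j), the coefficient of Λ r is C(m,r)(m+1-r) - C(m,r+1)(r+1) =
C(m,r), up to sign and the factor m + 1. -/
theorem sum_hook_telescope (m : ℕ) (Λ : ℕ → ℂ) :
    ∑ S : Finset (Fin (m + 1)), ((m + 1 - S.card : ℕ) : ℂ) * ((-1) ^ S.card *
      (((m + 1 - S.card : ℕ) : ℂ) * Λ S.card + (S.card : ℂ) * Λ (S.card - 1))) =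
    (m + 1 : ℂ) * ∑ r ∈ range (m + 1), (-1) ^ r * (m.choose r : ℂ) * Λ r := by
  have h1 := Finset.sum_powerset_apply_card (fun j => ((m + 1 - j : ℕ) : ℂ) * ((-1) ^ j *
      (((m + 1 - j : ℕ) : ℂ) * Λ j + (j : ℂ) * Λ (j - 1)))) (x := (univ : Finset (Fin (m + 1))))
  rw [powerset_univ, card_univ, Fintype.card_fin] at h1
  rw [h1]
  have h2 : ∀ j ∈ range (m + 1 + 1), (m + 1).choose j • (((m + 1 - j : ℕ) : ℂ) * ((-1) ^ j *
      (((m + 1 - j : ℕ) : ℂ) * Λ j + (j : ℂ) * Λ (j - 1)))) =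
      (m + 1 : ℂ) * ((-1) ^ j * (m.choose j : ℂ) *
        (((m + 1 - j : ℕ) : ℂ) * Λ j + (j : ℂ) * Λ (j - 1))) := by
    intro j hj
    have h3 : (((m + 1).choose j * (m + 1 - j) : ℕ) : ℂ) = ((m + 1) * m.choose j : ℕ) := by
      rw [← Nat.choose_mul_succ_eq, mul_comm]
    push_cast at h3
    rw [nsmul_eq_mul]
    linear_combination ((-1) ^ j * (((m + 1 - j : ℕ) : ℂ) * Λ j + (j : ℂ) * Λ (j - 1))) * h3
  rw [sum_congr rfl h2, ← mul_sum]
  congr 1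
  simp only [mul_add, sum_add_distrib]
  rw [sum_range_succ, sum_range_succ' (fun j => (-1 : ℂ) ^ j * (m.choose j : ℂ) *
    ((j : ℂ) * Λ (j - 1)))]
  simp only [Nat.choose_succ_self, Nat.cast_zero, mul_zero, zero_mul, add_zero]
  rw [← sum_add_distrib]
  refine sum_congr rfl fun r hr => ?_
  have h4 : ((m.choose (r + 1) * (r + 1) : ℕ) : ℂ) = (m.choose r * (m - r) : ℕ) := by
    rw [Nat.choose_succ_right_eq]
  have hr' : r ≤ m := by rw [mem_range] at hr; omega
  rw [Nat.add_sub_cancel, Nat.cast_sub (by omega)]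
  push_cast [Nat.cast_sub hr'] at h4 ⊢
  rw [pow_succ]
  linear_combination (-(-1) ^ r * Λ r) * h4

/-- Double counting of the alternating hook sum over pairs i ∉ S: summing over S first detects the
long cycles, on which the central product has constant coefficient; summing over i first gives the
hook contents. -/
theorem card_transitive_mul_coeff (ys : List ℂ) {m : ℕ} {c : Perm (Fin (m + 1))}
    (hc : IsTransitive c) [DecidablePred (IsTransitive (n := m + 1))] :
    ((m : ℂ) + 1) * ((univ.filter (IsTransitive (n := m + 1))).card : ℂ) *
      ((ys.map fun y => jmProduct y (m + 1)).prod).coeff c =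
    ∑ r ∈ range (m + 1), (-1) ^ r * (m.choose r : ℂ) * (ys.map (hookContent (m + 1) r)).prod := by
  classical
  have hm : ((m : ℂ) + 1) ≠ 0 := by exact_mod_cast Nat.succ_ne_zero m
  set P := (ys.map fun y => jmProduct y (m + 1)).prod with hP
  have hconj : ∀ π, IsTransitive π → P.coeff π⁻¹ = P.coeff c := by
    intro π hπ
    obtain ⟨g, hg⟩ := isConj_iff.1 (hc.isConj hπ.inv)
    rw [← hg, coeff_conj_of_commute (commute_list_prod_jmProduct ys)]
  have hiff : ∀ (i : Fin (m + 1)) (π : Perm (Fin (m + 1))),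
      (∀ x, π.SameCycle i x) ↔ IsTransitive π := fun i π =>
    ⟨fun h x y => (h x).symm.trans (h y), fun h x => h i x⟩
  have way1 : ∀ i : Fin (m + 1), ∑ S ∈ univ.filter (fun S : Finset (Fin (m + 1)) => i ∉ S),
      (-1 : ℂ) ^ S.card * (P * hookElement S Sᶜ).coeff 1 =
        ((univ.filter (IsTransitive (n := m + 1))).card : ℂ) * P.coeff c := by
    intro i
    simp only [coeff_mul_one, mul_sum]
    rw [sum_comm]
    have : ∀ π : Perm (Fin (m + 1)), ∑ S ∈ univ.filter (fun S : Finset (Fin (m + 1)) => i ∉ S),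
        (-1 : ℂ) ^ S.card * (P.coeff π⁻¹ * (hookElement S Sᶜ).coeff π) =
        if IsTransitive π then P.coeff c else 0 := by
      intro π
      simp only [mul_left_comm _ (P.coeff π⁻¹)]
      rw [← mul_sum, sum_coeff_hookElement]
      simp only [hiff]
      split_ifs with h
      · rw [hconj π h, mul_one]
      · simp
    rw [sum_congr rfl fun π _ => this π, ← sum_filter, sum_const, nsmul_eq_mul]
  have way2 : ∑ i : Fin (m + 1), ∑ S ∈ univ.filter (fun S : Finset (Fin (m + 1)) => i ∉ S),
      (-1 : ℂ) ^ S.card * (P * hookElement S Sᶜ).coeff 1 =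
      ∑ S : Finset (Fin (m + 1)), ((m + 1 - S.card : ℕ) : ℂ) * ((-1 : ℂ) ^ S.card *
        (P * hookElement S Sᶜ).coeff 1) := by
    simp only [sum_filter]
    rw [sum_comm]
    refine sum_congr rfl fun S _ => ?_
    rw [← sum_filter, sum_const, nsmul_eq_mul]
    congr 2
    have hcompl : (univ.filter fun i : Fin (m + 1) => i ∉ S) = Sᶜ := by
      ext i
      simp
    rw [hcompl, card_compl, Fintype.card_fin]
  rw [sum_congr rfl fun i _ => way1 i, sum_const, card_univ, Fintype.card_fin, nsmul_eq_mul] at way2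
  have h3 := sum_hook_telescope m fun r => (ys.map (hookContent (m + 1) r)).prod
  rw [← mul_right_inj' hm, ← h3, mul_assoc]
  push_cast at way2
  rw [way2, mul_sum]
  refine sum_congr rfl fun S _ => ?_
  rw [← card_mul_coeff_hookElement_compl]
  push_cast
  ring

/-- The number of long cycles is read off from the same formula with the single parameter y = 1: the
coefficient is then 1, and only r = 0 has nonzero content product, namely (m+1)!. -/
theorem factorial_mul_coeff (ys : List ℂ) {m : ℕ} {c : Perm (Fin (m + 1))}
    (hc : IsTransitive c) :
    ((m + 1).factorial : ℂ) * ((ys.map fun y => jmProduct y (m + 1)).prod).coeff c =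
    ∑ r ∈ range (m + 1), (-1) ^ r * (m.choose r : ℂ) * (ys.map (hookContent (m + 1) r)).prod := by
  classical
  have h1 := card_transitive_mul_coeff [1] hc
  rw [List.map_singleton, List.prod_singleton, coeff_jmProduct, one_pow, mul_one,
    sum_range_succ', sum_eq_zero] at h1
  · have h2 : hookContent (m + 1) 0 1 = ((m + 1).factorial : ℂ) := by
      rw [hookContent, ← prod_range_add_one_eq_factorial]
      push_cast
      exact prod_congr rfl fun l _ => by ring
    simp only [List.map_singleton, List.prod_singleton, h2] at h1
    rw [← card_transitive_mul_coeff ys hc, h1]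
    simp
  · intro r hr
    rw [mem_range] at hr
    have : hookContent (m + 1) (r + 1) 1 = 0 :=
      prod_eq_zero (mem_range.2 (by omega : r < m + 1)) (by push_cast; ring)
    simp [this]

end

/-! ### Coxeter elements -/

section

/-- The monomial matrix `[π; a]` as an element of the general linear group. -/
def monomialGL {d n : ℕ} (π : Perm (Fin n)) (a : Fin n → rootsOfUnity d ℂ) : GL (Fin n) ℂ where
  val := monomialMatrix π a
  inv := monomialMatrix π⁻¹ fun j => (a (π⁻¹ j))⁻¹
  val_inv := by
    rw [monomialMatrix_mul]
    simpa using monomialMatrix_one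
  inv_val := by
    rw [monomialMatrix_mul]
    simpa using monomialMatrix_one

theorem monomialGL_val {d n : ℕ} (π : Perm (Fin n)) (a : Fin n → rootsOfUnity d ℂ) :
    (monomialGL π a : Matrix (Fin n) (Fin n) ℂ) = monomialMatrix π a := rfl

theorem monomialGL_mem {d n : ℕ} (π : Perm (Fin n)) (a : Fin n → rootsOfUnity d ℂ) :
    monomialGL π a ∈ Gd1n d n := ⟨π, a, rfl⟩

theorem monomialGL_one {d n : ℕ} :
    monomialGL (1 : Perm (Fin n)) (1 : Fin n → rootsOfUnity d ℂ) = 1 :=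
  Units.ext monomialMatrix_one

/-- The coordinates of `v` are nonzero with distinct `d`-th powers: `v` lies on no reflecting
hyperplane of `G(d, 1, n)`. -/
def IsGeneric {n : ℕ} (d : ℕ) (v : Fin n → ℂ) : Prop :=
  (∀ i, v i ≠ 0) ∧ ∀ i j, v i ^ d = v j ^ d → i = j

theorem coe_rootsOfUnity_pow {d : ℕ} (ζ : rootsOfUnity d ℂ) : ((ζ : ℂˣ) : ℂ) ^ d = 1 := by
  rw [← Units.val_pow_eq_pow_val, (mem_rootsOfUnity d _).1 ζ.2, Units.val_one]

/-- Taking d-th powers removes the root of unity, so v_{σ j}^d = v_j^d forces σ = 1, and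
nonvanishing coordinates then force b = 1. -/
theorem IsGeneric.eq_one {d n : ℕ} {v : Fin n → ℂ} (hv : IsGeneric d v) {σ : Perm (Fin n)}
    {b : Fin n → rootsOfUnity d ℂ} (h : v ∈ fixSub σ b) : σ = 1 ∧ b = 1 := by
  rw [mem_fixSub] at h
  have hσ : σ = 1 := by
    ext j
    rw [hv.2 (σ j) j (by rw [h j, mul_pow, coe_rootsOfUnity_pow, one_mul])]
    rfl
  refine ⟨hσ, ?_⟩
  subst hσ
  ext j
  have h1 := h j
  rw [Perm.one_apply] at h1
  have h2 : (((b j : rootsOfUnity d ℂ) : ℂˣ) : ℂ) = 1 := by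
    have := hv.1 j
    field_simp at h1
    exact h1.symm
  simpa using h2

theorem isReflection_of_ker {d n : ℕ} {π : Perm (Fin n)} {a : Fin n → rootsOfUnity d ℂ}
    {f : Module.Dual ℂ (Fin n → ℂ)} (hf : f ≠ 0) (h : fixSub π a = LinearMap.ker f) :
    IsReflection (monomialGL π a) := by
  rw [IsReflection, fixDim_eq (monomialGL_val π a), h, Module.Dual.finrank_ker_add_one_of_ne_zero hf]
  simp

theorem isGeneric_of_regular {d n : ℕ} (hd : 1 < d) {v : Fin n → ℂ}
    (h : ∀ r ∈ Gd1n d n, IsReflection r → v ∉ fixedSpace r) : IsGeneric d v := by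
  have : NeZero d := ⟨by omega⟩
  obtain ⟨ζ, hζ⟩ : ∃ ζ : rootsOfUnity d ℂ, ζ ≠ 1 := by
    have : Nontrivial (rootsOfUnity d ℂ) := by
      rw [← Fintype.one_lt_card_iff_nontrivial, card_rootsOfUnity_complex]; exact hd
    exact exists_ne 1
  have hζ' : ((ζ : ℂˣ) : ℂ) ≠ 1 := by simpa using hζ
  have h0 : ∀ i, v i ≠ 0 := by
    intro i hi
    have hfix : fixSub 1 (Pi.mulSingle i ζ) =
        LinearMap.ker (LinearMap.proj i : Module.Dual ℂ (Fin n → ℂ)) := by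
      ext w
      rw [mem_fixSub, LinearMap.mem_ker, LinearMap.proj_apply]
      constructor
      · intro hw
        have h1 := hw i
        rw [Pi.mulSingle_eq_same, Perm.one_apply] at h1
        have : (((ζ : ℂˣ) : ℂ) - 1) * w i = 0 := by rw [sub_mul, one_mul, ← h1, sub_self]
        exact (mul_eq_zero.1 this).resolve_left (sub_ne_zero.2 hζ')
      · intro hw j
        by_cases hj : j = i
        · subst hj; simp [hw]
        · simp [Pi.mulSingle_eq_of_ne hj]
    have hne : (LinearMap.proj i : Module.Dual ℂ (Fin n → ℂ)) ≠ 0 := by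
      intro h0
      have := congrArg (fun f => f (Pi.single i 1)) h0
      simp at this
    refine h _ (monomialGL_mem _ _) (isReflection_of_ker hne hfix) ?_
    rw [fixedSpace_eq_fixSub (monomialGL_val _ _), hfix]
    simpa using hi
  refine ⟨h0, fun i j hij => ?_⟩
  by_contra hne
  have hpow : (v i / v j) ^ d = 1 := by
    rw [div_pow, hij, div_self (pow_ne_zero _ (h0 j))]
  -- With this ratio the twisted transposition of i and j is a reflection whose hyperplane w_i = ξ
  -- w_j contains v.
  set ξ : rootsOfUnity d ℂ := rootsOfUnity.mkOfPowEq (v i / v j) hpow with hξ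
  have hξv : ((ξ : ℂˣ) : ℂ) = v i / v j := rootsOfUnity.coe_mkOfPowEq hpow
  have hξ0 : ((ξ : ℂˣ) : ℂ) ≠ 0 := Units.ne_zero _
  have hfix : fixSub (swap i j) (Pi.mulSingle i ξ⁻¹ * Pi.mulSingle j ξ) =
      LinearMap.ker (LinearMap.proj i - ((ξ : ℂˣ) : ℂ) • LinearMap.proj j :
        Module.Dual ℂ (Fin n → ℂ)) := by
    ext w
    rw [mem_fixSub, LinearMap.mem_ker]
    simp only [LinearMap.sub_apply, LinearMap.smul_apply, LinearMap.proj_apply, smul_eq_mul,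
      sub_eq_zero]
    constructor
    · intro hw
      have h1 := hw j
      simpa [Pi.mulSingle_eq_of_ne (Ne.symm hne)] using h1
    · intro hw l
      by_cases hl : l = j
      · subst hl
        simpa [Pi.mulSingle_eq_of_ne (Ne.symm hne)] using hw
      · by_cases hl' : l = i
        · subst hl'
          simp [Pi.mulSingle_eq_of_ne hl, hw, hξ0]
        · simp [Pi.mulSingle_eq_of_ne hl, Pi.mulSingle_eq_of_ne hl', swap_apply_of_ne_of_ne hl' hl]
  have hne' : (LinearMap.proj i - ((ξ : ℂˣ) : ℂ) • LinearMap.proj j :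
      Module.Dual ℂ (Fin n → ℂ)) ≠ 0 := by
    intro h0
    have := congrArg (fun f => f (Pi.single i 1)) h0
    simp [hne] at this
  refine h _ (monomialGL_mem _ _) (isReflection_of_ker hne' hfix) ?_
  rw [fixedSpace_eq_fixSub (monomialGL_val _ _), hfix, LinearMap.mem_ker]
  simp [hξv, h0 j]

theorem IsGeneric.notMem_fixedSpace {d n : ℕ} {v : Fin n → ℂ} (hv : IsGeneric d v)
    {r : GL (Fin n) ℂ} (hr : r ∈ Gd1n d n) (hrefl : IsReflection r) : v ∉ fixedSpace r := by
  intro hmem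
  obtain ⟨σ, b, hσ⟩ := hr
  rw [fixedSpace_eq_fixSub hσ] at hmem
  obtain ⟨rfl, rfl⟩ := hv.eq_one hmem
  have htop : fixSub (1 : Perm (Fin n)) (1 : Fin n → rootsOfUnity d ℂ) = ⊤ := by
    ext w; simp [mem_fixSub]
  rw [IsReflection, fixDim_eq hσ, htop, finrank_top] at hrefl
  simp at hrefl

/-- Witness: the rotation with one nontrivial entry μ^n and eigenvector (1, μ⁻¹, μ⁻², …). Only the
resulting bound dn ≤ h is used later, not the value of h. -/
theorem isRegularNumber_mul {d n : ℕ} (hd : 1 < d) (hn : 0 < n) :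
    IsRegularNumber (Gd1n d n) (d * n) := by
  obtain ⟨m, rfl⟩ : ∃ m, n = m + 1 := ⟨n - 1, by omega⟩
  have hdn : d * (m + 1) ≠ 0 := by positivity
  set μ : ℂ := Complex.exp (2 * Real.pi * Complex.I / (d * (m + 1) : ℕ)) with hμdef
  have hμ : IsPrimitiveRoot μ (d * (m + 1)) := Complex.isPrimitiveRoot_exp _ hdn
  have hμ0 : μ ≠ 0 := hμ.ne_zero hdn
  have hpow : (μ ^ (m + 1)) ^ d = 1 := by rw [← pow_mul, mul_comm, hμ.pow_eq_one]
  have : NeZero d := ⟨by omega⟩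
  set ξ : rootsOfUnity d ℂ := rootsOfUnity.mkOfPowEq (μ ^ (m + 1)) hpow
  have hξ : ((ξ : ℂˣ) : ℂ) = μ ^ (m + 1) := rootsOfUnity.coe_mkOfPowEq hpow
  let v : Fin (m + 1) → ℂ := fun j => (μ⁻¹) ^ (j : ℕ)
  have hv : IsGeneric d v := by
    refine ⟨fun i => pow_ne_zero _ (inv_ne_zero hμ0), fun i j hij => ?_⟩
    simp only [v, ← pow_mul] at hij
    have := (hμ.inv).pow_inj (i := i * d) (j := j * d) ?_ ?_ hij
    · exact Fin.ext (Nat.eq_of_mul_eq_mul_right (by omega) this)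
    · rw [mul_comm d]; exact Nat.mul_lt_mul_of_pos_right i.2 (by omega)
    · rw [mul_comm d]; exact Nat.mul_lt_mul_of_pos_right j.2 (by omega)
  refine ⟨monomialGL (finRotate (m + 1)) (Pi.mulSingle (Fin.last m) ξ), monomialGL_mem _ _, μ, v,
    ⟨?_, fun r hr hrefl => hv.notMem_fixedSpace hr hrefl⟩, hμ⟩
  rw [Module.End.hasEigenvector_iff, Module.End.mem_eigenspace_iff]
  refine ⟨?_, fun h0 => hv.1 0 (by rw [h0]; rfl)⟩
  ext i
  obtain ⟨j, rfl⟩ := (finRotate (m + 1)).surjective i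
  rw [Matrix.toLin'_apply, monomialGL_val, monomialMatrix_mulVec, Pi.smul_apply, smul_eq_mul]
  refine Fin.lastCases ?_ (fun l => ?_) j
  · rw [Pi.mulSingle_eq_same, finRotate_last, hξ]
    simp [v, pow_succ]
    field_simp
  · rw [Pi.mulSingle_eq_of_ne (Fin.castSucc_lt_last l).ne, finRotate_apply,
      Fin.coeSucc_eq_succ]
    simp [v, pow_succ]
    field_simp

theorem coxeter_structure {d n : ℕ} (hd : 1 < d) {c : GL (Fin n) ℂ}
    (hc : IsCoxeterElement (Gd1n d n) c) :
    0 < n ∧ ∃ (π : Perm (Fin n)) (a : Fin n → rootsOfUnity d ℂ),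
      (c : Matrix (Fin n) (Fin n) ℂ) = monomialMatrix π a ∧ IsTransitive π ∧ ∏ i, a i ≠ 1 := by
  obtain ⟨⟨hcG, μ, v, hev, hreg⟩, hcox⟩ := hc
  have hv := isGeneric_of_regular hd hreg
  have hn : 0 < n := by
    rcases Nat.eq_zero_or_pos n with rfl | h
    · exact absurd (Subsingleton.elim v 0) hev.2
    · exact h
  have hle : d * n ≤ orderOf c := hcox.2 (isRegularNumber_mul hd hn)
  have hcG2 := hcG
  obtain ⟨π, a, hπ⟩ := hcG
  have hpow_vec : ∀ k : ℕ, ((c ^ k : GL (Fin n) ℂ) : Matrix (Fin n) (Fin n) ℂ).mulVec v =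
      μ ^ k • v := by
    intro k
    have := hev.pow_apply k
    rwa [← Matrix.toLin'_pow, Matrix.toLin'_apply, ← Units.val_pow_eq_pow_val] at this
  -- If μ^k = 1 then c^k fixes the generic vector v, so c^k = 1 and the order of c, at least dn,
  -- divides k.
  have hord : ∀ k : ℕ, 0 < k → μ ^ k = 1 → d * n ≤ k := by
    intro k hk hμk
    have h1 := hpow_vec k
    rw [hμk, one_smul] at h1
    have hmem : c ^ k ∈ Gd1n d n := Subgroup.pow_mem _ hcG2 k
    obtain ⟨σ, b, hσ⟩ := hmem
    have h2 : v ∈ fixSub σ b := by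
      rw [← fixedSpace_eq_fixSub hσ, fixedSpace, LinearMap.mem_eqLocus, Matrix.toLin'_apply, h1]
      rfl
    obtain ⟨rfl, rfl⟩ := hv.eq_one h2
    have h3 : c ^ k = 1 := Units.ext (hσ.trans monomialMatrix_one)
    exact hle.trans (Nat.le_of_dvd hk (orderOf_dvd_of_pow_eq_one h3))
  have hstep : ∀ j, μ * v (π j) = ((a j : ℂˣ) : ℂ) * v j := by
    intro j
    have h1 := congrFun (hpow_vec 1) (π j)
    rw [pow_one, hπ, monomialMatrix_mulVec, pow_one, Pi.smul_apply, smul_eq_mul] at h1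
    exact h1.symm
  -- The eigenvector equations are multiplied over an invariant set A and ∏ v cancelled. Then
  -- μ^{d|A|} = 1, so an orbit smaller than n contradicts `hord`; so does ∏ a = 1, which would give
  -- μ^n = 1.
  have hprod : ∀ A : Finset (Fin n), (∀ i, π i ∈ A ↔ i ∈ A) →
      μ ^ A.card = ((∏ i ∈ A, a i : rootsOfUnity d ℂ) : ℂˣ) := by
    intro A hA
    have h1 : ∏ j ∈ A, v (π j) = ∏ j ∈ A, v j :=
      prod_nbij' (fun j => π j) (fun j => π⁻¹ j) (fun j hj => (hA j).2 hj)
        (fun j hj => by rw [← hA]; simpa using hj) (by simp) (by simp) (by simp)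
    have h2 := prod_congr (rfl : A = A) fun j _ => hstep j
    rw [prod_mul_distrib, prod_mul_distrib, prod_const, h1] at h2
    have h3 := mul_right_cancel₀ (prod_ne_zero_iff.2 fun j _ => hv.1 j) h2
    rw [h3]
    push_cast
    rfl
  refine ⟨hn, π, a, hπ, ?_, ?_⟩
  · intro x y
    by_contra hxy
    have hA : ∀ j, π j ∈ orbitFinset π x ↔ j ∈ orbitFinset π x := fun j => by
      rw [mem_orbitFinset, mem_orbitFinset, Perm.sameCycle_apply_right]
    have h1 := hprod _ hA
    have hpos : 0 < (orbitFinset π x).card :=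
      card_pos.2 ⟨x, mem_orbitFinset.2 (Perm.SameCycle.refl _ _)⟩
    have hlt : (orbitFinset π x).card < n := by
      have := card_lt_univ_of_notMem (s := orbitFinset π x) (x := y)
        fun h => hxy (mem_orbitFinset.1 h)
      simpa using this
    have h2 := hord (d * (orbitFinset π x).card) (by positivity) (by
      rw [mul_comm, pow_mul, h1, coe_rootsOfUnity_pow])
    have := Nat.le_of_mul_le_mul_left h2 (by omega)
    omega
  · intro h1
    have h2 := hprod univ (by simp)
    rw [h1, card_univ, Fintype.card_fin] at h2
    have h3 := hord n hn (by simpa using h2)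
    nlinarith

end

/-! ### Factorization sums -/

section

theorem monomialMatrix_injective {d n : ℕ} {π σ : Perm (Fin n)} {a b : Fin n → rootsOfUnity d ℂ}
    (h : monomialMatrix π a = monomialMatrix σ b) : π = σ ∧ a = b := by
  have key : ∀ j, π j = σ j ∧ a j = b j := by
    intro j
    have h1 := congrFun (congrFun h (π j)) j
    simp only [monomialMatrix, Matrix.of_apply, if_true] at h1
    split_ifs at h1 with h2
    · exact ⟨h2, by ext; exact h1⟩
    · exact absurd h1 (Units.ne_zero _)
  exact ⟨Equiv.ext fun j => (key j).1, funext fun j => (key j).2⟩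

/-- Coordinates on `G(d, 1, n)`: the underlying permutation and the nonzero entries. -/
def gdEquiv (d n : ℕ) : Perm (Fin n) × (Fin n → rootsOfUnity d ℂ) ≃ Gd1n d n :=
  Equiv.ofBijective (fun p => ⟨monomialGL p.1 p.2, monomialGL_mem p.1 p.2⟩) (by
    constructor
    · rintro ⟨π, a⟩ ⟨σ, b⟩ h
      have h1 : monomialMatrix π a = monomialMatrix σ b :=
        congrArg (fun g : Gd1n d n => ((g : GL (Fin n) ℂ) : Matrix (Fin n) (Fin n) ℂ)) h
      obtain ⟨rfl, rfl⟩ := monomialMatrix_injective h1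
      rfl
    · rintro ⟨g, π, a, hg⟩
      exact ⟨(π, a), Subtype.ext (Units.ext hg.symm)⟩)

variable {d n : ℕ}

/-- The underlying permutation of a monomial matrix. -/
def perm (g : Gd1n d n) : Perm (Fin n) := ((gdEquiv d n).symm g).1

/-- The nonzero entries of a monomial matrix. -/
def phase (g : Gd1n d n) : Fin n → rootsOfUnity d ℂ := ((gdEquiv d n).symm g).2

@[simp] theorem perm_gdEquiv (π : Perm (Fin n)) (a : Fin n → rootsOfUnity d ℂ) :
    perm (gdEquiv d n (π, a)) = π := by simp [perm]

@[simp] theorem phase_gdEquiv (π : Perm (Fin n)) (a : Fin n → rootsOfUnity d ℂ) :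
    phase (gdEquiv d n (π, a)) = a := by simp [phase]

theorem gdEquiv_perm_phase (g : Gd1n d n) : gdEquiv d n (perm g, phase g) = g :=
  (gdEquiv d n).apply_symm_apply g

theorem gdEquiv_mul (π σ : Perm (Fin n)) (a b : Fin n → rootsOfUnity d ℂ) :
    gdEquiv d n (π, a) * gdEquiv d n (σ, b) = gdEquiv d n (π * σ, fun j => a (σ j) * b j) :=
  Subtype.ext (Units.ext (monomialMatrix_mul π σ a b))

theorem perm_mul (g h : Gd1n d n) : perm (g * h) = perm g * perm h := by
  rw [← gdEquiv_perm_phase g, ← gdEquiv_perm_phase h, gdEquiv_mul]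
  simp

theorem phase_mul (g h : Gd1n d n) (j : Fin n) :
    phase (g * h) j = phase g (perm h j) * phase h j := by
  rw [← gdEquiv_perm_phase g, ← gdEquiv_perm_phase h, gdEquiv_mul]
  simp

theorem gdEquiv_one : gdEquiv d n (1, 1) = 1 := Subtype.ext monomialGL_one

theorem fixDim_gdEquiv (π : Perm (Fin n)) (a : Fin n → rootsOfUnity d ℂ) :
    fixDim (gdEquiv d n (π, a) : GL (Fin n) ℂ) = Module.finrank ℂ (fixSub π a) :=
  fixDim_eq rfl

/-- The homomorphism `[π; a] ↦ χ (∏ a) • π` to the group algebra of the symmetric group. -/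
def twistHom (n : ℕ) (χ : rootsOfUnity d ℂ →* ℂ) :
    Gd1n d n →* MonoidAlgebra ℂ (Perm (Fin n)) where
  toFun g := χ (∏ i, phase g i) • MonoidAlgebra.of ℂ _ (perm g)
  map_one' := by
    rw [← gdEquiv_one]
    simp [MonoidAlgebra.one_def]
  map_mul' g h := by
    have : ∏ i, phase (g * h) i = (∏ i, phase g i) * ∏ i, phase h i := by
      simp only [phase_mul, prod_mul_distrib]
      rw [(perm h).prod_comp univ (phase g) (by simp)]
    rw [this, perm_mul, map_mul, map_mul, smul_mul_smul_comm]

variable [NeZero d]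

instance fintypeGd1n : Fintype (Gd1n d n) := Fintype.ofEquiv _ (gdEquiv d n)

theorem card_Gd1n : Fintype.card (Gd1n d n) = d ^ n * n.factorial := by
  rw [← Fintype.card_congr (gdEquiv d n), Fintype.card_prod, Fintype.card_perm, Fintype.card_fun,
    card_rootsOfUnity_complex, Fintype.card_fin, mul_comm]

theorem list_prod_ofFn_sum {G A : Type*} [Monoid G] [Fintype G] [Semiring A] [Algebra ℂ A]
    (φ : G →* A) {k : ℕ} (f : Fin k → G → ℂ) :
    (List.ofFn fun i => ∑ g, f i g • φ g).prod =
      ∑ u : Fin k → G, (∏ i, f i (u i)) • φ (List.ofFn u).prod := by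
  induction k with
  | zero => simp
  | succ k ih =>
    rw [List.ofFn_succ, List.prod_cons, ih fun i => f i.succ, sum_mul_sum,
      ← (Fin.consEquiv fun _ => G).sum_comp, Fintype.sum_prod_type]
    refine sum_congr rfl fun g _ => sum_congr rfl fun u _ => ?_
    rw [smul_mul_smul_comm, ← map_mul]
    simp [Fin.consEquiv, Fin.prod_univ_succ, List.ofFn_succ]

open Classical in
/-- The factorizations of `g` into `k` factors, weighted by `∏ x_i ^ fixDim u_i`. -/
def weightedCount {k : ℕ} (x : Fin k → ℂ) (g : Gd1n d n) : ℂ :=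
  ∑ u ∈ univ.filter (fun u : Fin k → Gd1n d n => (List.ofFn u).prod = g),
    ∏ i, x i ^ fixDim (u i : GL (Fin n) ℂ)

theorem list_prod_eq_sum_weightedCount {A : Type*} [Semiring A] [Algebra ℂ A]
    (φ : Gd1n d n →* A) {k : ℕ} (x : Fin k → ℂ) :
    (List.ofFn fun i => ∑ g : Gd1n d n, x i ^ fixDim (g : GL (Fin n) ℂ) • φ g).prod =
      ∑ g, weightedCount x g • φ g := by
  classical
  rw [list_prod_ofFn_sum φ fun i g => x i ^ fixDim (g : GL (Fin n) ℂ),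
    ← sum_fiberwise (s := univ) (g := fun u : Fin k → Gd1n d n => (List.ofFn u).prod)]
  refine sum_congr rfl fun g _ => ?_
  rw [weightedCount, sum_smul]
  refine sum_congr (by congr!) fun u hu => ?_
  rw [(mem_filter.1 hu).2]

theorem fixDim_conj (g u : GL (Fin n) ℂ) : fixDim (g * u * g⁻¹) = fixDim u := by
  let e : (Fin n → ℂ) ≃ₗ[ℂ] (Fin n → ℂ) := LinearEquiv.ofLinearMap
    (Matrix.toLin' ((g⁻¹ : GL (Fin n) ℂ) : Matrix (Fin n) (Fin n) ℂ))
    (Matrix.toLin' (g : Matrix (Fin n) (Fin n) ℂ))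
    (by rw [← Matrix.toLin'_mul, ← Units.val_mul]; simp)
    (by rw [← Matrix.toLin'_mul, ← Units.val_mul]; simp)
  have : fixedSpace (g * u * g⁻¹) = (fixedSpace u).comap
      (e : (Fin n → ℂ) →ₗ[ℂ] (Fin n → ℂ)) := by
    ext v
    rw [Submodule.mem_comap, fixedSpace, fixedSpace, LinearMap.mem_eqLocus, LinearMap.mem_eqLocus,
      ← e.injective.eq_iff]
    simp only [e, LinearEquiv.coe_ofLinearMap, LinearEquiv.coe_coe, Matrix.toLin'_apply,
      Matrix.mulVec_mulVec, ← Units.val_mul, LinearMap.id_apply]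
    rw [show g⁻¹ * (g * u * g⁻¹) = u * g⁻¹ by group]
  rw [fixDim, this, fixDim]
  exact LinearEquiv.finrank_eq (LinearEquiv.ofSubmodule' _ _)

theorem coeff_sum_smul_of {G : Type*} [Monoid G] [Fintype G] (f : G → ℂ) (h : G) :
    (∑ g, f g • MonoidAlgebra.of ℂ G g).coeff h = f h := by
  classical
  rw [MonoidAlgebra.coeff_sum, Finsupp.finsetSum_apply]
  simp only [MonoidAlgebra.coeff_smul_apply, coeff_of, smul_eq_mul, mul_ite, mul_one, mul_zero]
  simp

/-- The weighted sums have class functions as coefficients, so they and their product are central.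
-/
theorem weightedCount_conj {k : ℕ} (x : Fin k → ℂ) (g u : Gd1n d n) :
    weightedCount x (g * u * g⁻¹) = weightedCount x u := by
  have h1 := list_prod_eq_sum_weightedCount (MonoidAlgebra.of ℂ (Gd1n d n)) x
  have hcomm : ∀ g, Commute (MonoidAlgebra.of ℂ (Gd1n d n) g)
      (∑ g, weightedCount x g • MonoidAlgebra.of ℂ (Gd1n d n) g) := by
    intro g
    rw [← h1]
    refine Commute.list_prod_right _ _ fun z hz => ?_
    rw [List.mem_ofFn] at hz
    obtain ⟨i, rfl⟩ := hz
    refine commute_of_coeff_conj _ (fun g u => ?_) g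
    rw [coeff_sum_smul_of, coeff_sum_smul_of]
    congr 1
    exact fixDim_conj _ _
  have := coeff_conj_of_commute hcomm g u
  rwa [coeff_sum_smul_of, coeff_sum_smul_of] at this

theorem eq_sum_coeff_smul_of {G : Type*} [Monoid G] [Fintype G] (z : MonoidAlgebra ℂ G) :
    z = ∑ g, z.coeff g • MonoidAlgebra.of ℂ G g := by
  ext h
  rw [coeff_sum_smul_of]

theorem sum_gd {M : Type*} [AddCommMonoid M] (f : Gd1n d n → M) :
    ∑ g, f g = ∑ π : Perm (Fin n), ∑ a : Fin n → rootsOfUnity d ℂ, f (gdEquiv d n (π, a)) := by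
  rw [← (gdEquiv d n).sum_comp, Fintype.sum_prod_type]

theorem sum_smul_twistHom (χ : rootsOfUnity d ℂ →* ℂ) (F : Gd1n d n → ℂ) :
    ∑ g, F g • twistHom n χ g = ∑ π : Perm (Fin n),
      (∑ a : Fin n → rootsOfUnity d ℂ, χ (∏ i, a i) * F (gdEquiv d n (π, a))) •
        MonoidAlgebra.of ℂ _ π := by
  rw [sum_gd]
  refine sum_congr rfl fun π _ => ?_
  rw [sum_smul]
  refine sum_congr rfl fun a _ => ?_
  simp only [twistHom, MonoidHom.coe_mk, OneHom.coe_mk, phase_gdEquiv, perm_gdEquiv, smul_smul]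
  rw [mul_comm]

theorem sum_char_mul_weightedCount (χ : rootsOfUnity d ℂ →* ℂ) {k : ℕ} (x y : Fin k → ℂ)
    (hy : ∀ i, d * y i = x i - 1 + ∑ ζ, χ ζ) (π : Perm (Fin n)) :
    ∑ a : Fin n → rootsOfUnity d ℂ, χ (∏ i, a i) * weightedCount x (gdEquiv d n (π, a)) =
      (d : ℂ) ^ (n * k) * (((List.ofFn y).map fun z => jmProduct z n).prod).coeff π := by
  have h1 := list_prod_eq_sum_weightedCount (twistHom n χ) x
  have h2 : ∀ i, ∑ g : Gd1n d n, x i ^ fixDim (g : GL (Fin n) ℂ) • twistHom n χ g =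
      (d : ℂ) ^ n • jmProduct (y i) n := by
    intro i
    rw [sum_smul_twistHom, eq_sum_coeff_smul_of (jmProduct (y i) n), smul_sum]
    refine sum_congr rfl fun σ _ => ?_
    rw [smul_smul, ← twistedSum_eq χ (x i) (y i) (hy i), twistedSum]
    simp only [fixDim_gdEquiv]
  rw [sum_smul_twistHom] at h1
  have h3 := congrArg (fun z => z.coeff π) h1
  simp only [coeff_sum_smul_of] at h3
  rw [← h3]
  simp only [h2]
  have h4 : ∀ (ys : List ℂ), (ys.map fun z => (d : ℂ) ^ n • jmProduct z n).prod =
      (d : ℂ) ^ (n * ys.length) • (ys.map fun z => jmProduct z n).prod := by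
    intro ys
    induction ys with
    | nil => simp
    | cons z ys ih =>
      rw [List.map_cons, List.prod_cons, ih, smul_mul_smul_comm, List.map_cons, List.prod_cons,
        List.length_cons, ← pow_add]
      congr 2
      ring
  have h5 := h4 (List.ofFn y)
  rw [List.map_ofFn, List.length_ofFn] at h5
  have h6 : (List.ofFn fun i => (d : ℂ) ^ n • jmProduct (y i) n) =
    List.ofFn ((fun z => (d : ℂ) ^ n • jmProduct z n) ∘ y) := rfl
  rw [h6, h5, MonoidAlgebra.coeff_smul_apply, smul_eq_mul]

end

/-! ### Character sums -/

section

variable {d n : ℕ}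

/-- The character `ζ ↦ ζ ^ s` of the group of `d`-th roots of unity. -/
def powChar (d s : ℕ) : rootsOfUnity d ℂ →* ℂ where
  toFun ζ := ((ζ : ℂˣ) : ℂ) ^ s
  map_one' := by simp
  map_mul' a b := by simp [mul_pow]

theorem powChar_apply (s : ℕ) (ζ : rootsOfUnity d ℂ) : powChar d s ζ = ((ζ : ℂˣ) : ℂ) ^ s := rfl

theorem sum_range_pow_rootsOfUnity (ζ : rootsOfUnity d ℂ) [Decidable (ζ = 1)] :
    ∑ s ∈ range d, ((ζ : ℂˣ) : ℂ) ^ s = if ζ = 1 then (d : ℂ) else 0 := by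
  split_ifs with h
  · subst h; simp
  · have h1 : ((ζ : ℂˣ) : ℂ) ≠ 1 := by simpa using h
    have h2 := mul_geom_sum ((ζ : ℂˣ) : ℂ) d
    rw [coe_rootsOfUnity_pow, sub_self] at h2
    exact (mul_eq_zero.1 h2).resolve_left (sub_ne_zero.2 h1)

variable [NeZero d]

theorem sum_powChar_zero : ∑ ζ, powChar d 0 ζ = d := by
  simp [powChar_apply, card_rootsOfUnity_complex]

theorem sum_powChar_of_pos {s : ℕ} (hs : 0 < s) (hsd : s < d) : ∑ ζ, powChar d s ζ = 0 := by
  have hprim := Complex.isPrimitiveRoot_exp d (NeZero.ne d)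
  set ω : rootsOfUnity d ℂ := rootsOfUnity.mkOfPowEq _ hprim.pow_eq_one
  have hω : powChar d s ω ≠ 1 := by
    rw [powChar_apply, rootsOfUnity.coe_mkOfPowEq]
    exact hprim.pow_ne_one_of_pos_of_lt hs.ne' hsd
  have h1 : powChar d s ω * ∑ ζ, powChar d s ζ = ∑ ζ, powChar d s ζ := by
    rw [mul_sum]
    simp only [← map_mul]
    exact Equiv.sum_comp (Equiv.mulLeft ω) fun ζ => powChar d s ζ
  have h2 : (powChar d s ω - 1) * ∑ ζ, powChar d s ζ = 0 := by rw [sub_mul, one_mul, h1, sub_self]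
  exact (mul_eq_zero.1 h2).resolve_left (sub_ne_zero.2 hω)

/-- Counting: the kernel of t ↦ t(π j) t(j)⁻¹ consists of constants as π is transitive, so its image
is large enough to fill the kernel of the product map, which contains it. -/
theorem exists_diagonal_conj {m : ℕ} {π : Perm (Fin (m + 1))} (hπ : IsTransitive π)
    {b : Fin (m + 1) → rootsOfUnity d ℂ} (hb : ∏ i, b i = 1) :
    ∃ t : Fin (m + 1) → rootsOfUnity d ℂ, ∀ j, t (π j) * (t j)⁻¹ = b j := by
  let D : (Fin (m + 1) → rootsOfUnity d ℂ) →* (Fin (m + 1) → rootsOfUnity d ℂ) :=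
    { toFun := fun t j => t (π j) * (t j)⁻¹
      map_one' := by ext; simp
      map_mul' := fun s t => by
        funext j
        simp only [Pi.mul_apply, mul_inv]
        exact mul_mul_mul_comm _ _ _ _ }
  let p : (Fin (m + 1) → rootsOfUnity d ℂ) →* rootsOfUnity d ℂ :=
    { toFun := fun t => ∏ i, t i
      map_one' := by simp
      map_mul' := fun s t => by simp [prod_mul_distrib] }
  have hp : Function.Surjective p := fun ζ => ⟨Pi.mulSingle 0 ζ, by
    change ∏ i, (Pi.mulSingle 0 ζ : Fin (m + 1) → rootsOfUnity d ℂ) i = ζ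
    rw [Finset.prod_pi_mulSingle' 0 ζ univ, if_pos (mem_univ _)]⟩
  have hle : D.range ≤ p.ker := by
    rintro _ ⟨t, rfl⟩
    change ∏ j, t (π j) * (t j)⁻¹ = 1
    rw [prod_mul_distrib, (Equiv.prod_comp π t), ← prod_mul_distrib]
    simp
  have hker : Nat.card D.ker ≤ d := by
    refine (Nat.card_le_card_of_injective (fun t : D.ker => t.1 0) ?_).trans
      (Complex.card_rootsOfUnity d).le
    rintro ⟨s, hs⟩ ⟨t, ht⟩ hst
    have key : ∀ {u : Fin (m + 1) → rootsOfUnity d ℂ}, u ∈ D.ker → ∀ j, u j = u 0 := by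
      intro u hu j
      have h1 : ∀ j, u (π j) = u j := fun j => mul_inv_eq_one.1 (congrFun hu j)
      obtain ⟨k, -, rfl⟩ := (hπ 0 j).exists_pow_eq'
      induction k with
      | zero => simp
      | succ k ih => rw [pow_succ', Perm.mul_apply, h1, ih]
    refine Subtype.ext (funext fun j => ?_)
    exact (key hs j).trans (hst.trans (key ht j).symm)
  have e1 := D.ker.card_mul_index
  rw [Subgroup.index_ker] at e1
  have e2 := p.ker.card_mul_index
  rw [Subgroup.index_ker, MonoidHom.range_eq_top.2 hp, Subgroup.card_top,
    Complex.card_rootsOfUnity d] at e2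
  have hcard : Nat.card p.ker ≤ Nat.card D.range := by
    have h3 : Nat.card p.ker * d ≤ Nat.card D.range * d := by
      rw [e2, ← e1, mul_comm]
      exact Nat.mul_le_mul_left _ hker
    exact Nat.le_of_mul_le_mul_right h3 (NeZero.pos d)
  have heq := Subgroup.eq_of_le_of_card_ge hle hcard
  have hbm : b ∈ D.range := by
    rw [heq]
    exact hb
  obtain ⟨t, ht⟩ := hbm
  exact ⟨t, fun j => congrFun ht j⟩

theorem weightedCount_eq_of_prod_eq {m k : ℕ} (x : Fin k → ℂ) {π : Perm (Fin (m + 1))}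
    (hπ : IsTransitive π) {a b : Fin (m + 1) → rootsOfUnity d ℂ} (h : ∏ i, a i = ∏ i, b i) :
    weightedCount x (gdEquiv d (m + 1) (π, b)) = weightedCount x (gdEquiv d (m + 1) (π, a)) := by
  obtain ⟨t, ht⟩ := exists_diagonal_conj hπ (b := fun j => b j * (a j)⁻¹)
    (by rw [prod_mul_distrib, prod_inv_distrib, h, mul_inv_cancel])
  rw [← weightedCount_conj x (gdEquiv d (m + 1) (1, t)) (gdEquiv d (m + 1) (π, a))]
  congr 1
  rw [eq_mul_inv_iff_mul_eq, gdEquiv_mul, gdEquiv_mul]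
  congr 2
  funext j
  have h1 : t (π j) = b j * (a j)⁻¹ * t j := by
    rw [← ht j]; simp
  rw [h1, mul_right_comm, inv_mul_cancel_right, Perm.one_apply]

theorem card_prod_eq {m : ℕ} (δ : rootsOfUnity d ℂ)
    [DecidablePred fun a : Fin (m + 1) → rootsOfUnity d ℂ => ∏ i, a i = δ] :
    ∑ a : Fin (m + 1) → rootsOfUnity d ℂ, (if ∏ i, a i = δ then (1 : ℂ) else 0) = (d : ℂ) ^ m := by
  classical
  rw [sum_fin_succ_rootsOfUnity, sum_comm]
  have : ∀ a : Fin m → rootsOfUnity d ℂ, ∑ ζ : rootsOfUnity d ℂ,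
      (if ∏ i, (Fin.cons ζ a : Fin (m + 1) → rootsOfUnity d ℂ) i = δ then (1 : ℂ) else 0) = 1 := by
    intro a
    simp only [Fin.prod_univ_succ, Fin.cons_zero, Fin.cons_succ, ← eq_mul_inv_iff_mul_eq]
    simp
  rw [sum_congr rfl fun a _ => this a]
  simp [card_rootsOfUnity_complex]

/-- Fourier inversion over the characters ζ ↦ ζ^s: s = 0 yields Q₁, every other s yields Q₀. -/
theorem weightedCount_eq {m k : ℕ} (z : Fin k → ℂ) {π : Perm (Fin (m + 1))}
    (hπ : IsTransitive π) {a : Fin (m + 1) → rootsOfUnity d ℂ} (ha : ∏ i, a i ≠ 1) :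
    (d : ℂ) ^ (m + 1) * weightedCount (fun i => 1 + d * z i) (gdEquiv d (m + 1) (π, a)) =
      (d : ℂ) ^ ((m + 1) * k) *
        ((((List.ofFn fun i => z i + 1).map fun y => jmProduct y (m + 1)).prod).coeff π -
          (((List.ofFn z).map fun y => jmProduct y (m + 1)).prod).coeff π) := by
  classical
  set x : Fin k → ℂ := fun i => 1 + d * z i with hx
  set δ := ∏ i, a i with hδ
  set Q₁ := (((List.ofFn fun i => z i + 1).map fun y => jmProduct y (m + 1)).prod).coeff π
  set Q₀ := (((List.ofFn z).map fun y => jmProduct y (m + 1)).prod).coeff π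
  have hchar : ∀ s ∈ range d, ∑ b : Fin (m + 1) → rootsOfUnity d ℂ,
      powChar d s (∏ i, b i) * weightedCount x (gdEquiv d (m + 1) (π, b)) =
        (d : ℂ) ^ ((m + 1) * k) * (Q₀ + if s = 0 then Q₁ - Q₀ else 0) := by
    intro s hs
    split_ifs with h0
    · subst h0
      rw [sum_char_mul_weightedCount (powChar d 0) x (fun i => z i + 1) (fun i => by
        rw [sum_powChar_zero, hx]; ring)]
      simp [Q₁]
    · rw [sum_char_mul_weightedCount (powChar d s) x z (fun i => by
        rw [sum_powChar_of_pos (by omega) (mem_range.1 hs), hx]; ring)]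
      simp [Q₀]
  have lhs : ∑ s ∈ range d, powChar d s δ⁻¹ * ∑ b : Fin (m + 1) → rootsOfUnity d ℂ,
      powChar d s (∏ i, b i) * weightedCount x (gdEquiv d (m + 1) (π, b)) =
      (d : ℂ) ^ (m + 1) * weightedCount x (gdEquiv d (m + 1) (π, a)) := by
    simp only [mul_sum]
    rw [sum_comm]
    have : ∀ b : Fin (m + 1) → rootsOfUnity d ℂ, ∑ s ∈ range d, powChar d s δ⁻¹ *
        (powChar d s (∏ i, b i) * weightedCount x (gdEquiv d (m + 1) (π, b))) =
        (if ∏ i, b i = δ then (1 : ℂ) else 0) *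
          (d * weightedCount x (gdEquiv d (m + 1) (π, a))) := by
      intro b
      simp only [← mul_assoc, ← map_mul]
      rw [← sum_mul]
      simp only [powChar_apply]
      rw [sum_range_pow_rootsOfUnity]
      by_cases hb : ∏ i, b i = δ
      · rw [if_pos (by rw [hb, inv_mul_cancel]), if_pos hb,
          weightedCount_eq_of_prod_eq x hπ (a := a) (b := b) hb.symm, one_mul]
      · rw [if_neg (by rw [inv_mul_eq_one]; exact fun h => hb h.symm), if_neg hb]
        simp
    rw [sum_congr rfl fun b _ => this b, ← sum_mul, card_prod_eq, pow_succ]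
    ring
  rw [← lhs, sum_congr rfl fun s hs => by rw [hchar s hs]]
  simp only [mul_left_comm _ ((d : ℂ) ^ ((m + 1) * k)), mul_add, sum_add_distrib, ← mul_sum,
    ← sum_mul]
  -- Here ∏ a ≠ 1 enters: the character values at δ⁻¹ sum to zero, killing the uniform Q₀ part and
  -- leaving Q₁ - Q₀ from s = 0.
  have h1 : ∑ s ∈ range d, powChar d s δ⁻¹ = 0 := by
    simp only [powChar_apply]
    rw [sum_range_pow_rootsOfUnity, if_neg (by simpa using ha)]
  rw [h1]
  simp [NeZero.pos d, powChar_apply]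

end

/-! ### Binomial identities -/

section

theorem sum_alternating_choose_succ {R : Type*} [CommRing R] (m : ℕ) (F : ℕ → R) :
    ∑ t ∈ range (m + 2), (-1) ^ t * ((m + 1).choose t : R) * F t =
      ∑ t ∈ range (m + 1), (-1) ^ t * (m.choose t : R) * (F t - F (t + 1)) := by
  have h1 : ∑ t ∈ range (m + 1), (-1) ^ t * (m.choose t : R) * F t =
      ∑ t ∈ range (m + 1), (-1) ^ (t + 1) * (m.choose (t + 1) : R) * F (t + 1) + F 0 := by
    rw [sum_range_succ', sum_range_succ (fun t => (-1) ^ (t + 1) * (m.choose (t + 1) : R) *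
      F (t + 1))]
    simp
  simp only [mul_sub, sum_sub_distrib]
  rw [h1, sum_range_succ']
  simp only [Nat.choose_succ_succ', Nat.cast_add, pow_zero, Nat.choose_zero_right, Nat.cast_one,
    one_mul, mul_one]
  rw [add_sub_right_comm, ← sum_sub_distrib]
  congr 1
  refine sum_congr rfl fun t _ => ?_
  ring

/-- The binomial coefficient `C(n-t, p-t)`, zero for `p < t`. -/
def shiftedChoose (n t p : ℕ) : ℕ := if t ≤ p then (n - t).choose (p - t) else 0

/-- A range of t independent of p allows the sums over p and t to be exchanged. With k = 0 the
infimum would default to 0, hence k ≥ 1. -/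
theorem Mcoeff_eq (n : ℕ) {k : ℕ} (hk : 1 ≤ k) (p : Fin k → ℕ) :
    Mcoeff n p = ∑ t ∈ range (n + 1),
      (-1) ^ t * (n.choose t : ℤ) * ∏ i, (shiftedChoose n t (p i) : ℤ) := by
  have : Nonempty (Fin k) := ⟨⟨0, by omega⟩⟩
  have hmem : ∀ t, t ∈ range ((⨅ i, p i) + 1) ↔ ∀ i, t ≤ p i := fun t => by
    rw [mem_range, Nat.lt_succ_iff, le_ciInf_iff (OrderBot.bddBelow _)]
  have h1 : Mcoeff n p = ∑ t ∈ range ((⨅ i, p i) + 1),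
      (-1) ^ t * (n.choose t : ℤ) * ∏ i, (shiftedChoose n t (p i) : ℤ) := by
    refine sum_congr rfl fun t ht => ?_
    rw [hmem] at ht
    simp [shiftedChoose, ht]
  rw [h1]
  have key : ∀ s : Finset ℕ, (∀ t, t ∉ s → (-1) ^ t * (n.choose t : ℤ) *
      ∏ i, (shiftedChoose n t (p i) : ℤ) = 0) →
      ∑ t ∈ s, (-1) ^ t * (n.choose t : ℤ) * ∏ i, (shiftedChoose n t (p i) : ℤ) =
      ∑ᶠ t, (-1) ^ t * (n.choose t : ℤ) * ∏ i, (shiftedChoose n t (p i) : ℤ) := by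
    intro s hs
    refine (finsum_eq_sum_of_support_subset _ fun t ht => ?_).symm
    by_contra hts
    exact ht (hs t hts)
  rw [key, key]
  · intro t ht
    rw [mem_range, not_lt] at ht
    rw [Nat.choose_eq_zero_of_lt (by omega)]
    simp
  · intro t ht
    rw [hmem, not_forall] at ht
    obtain ⟨i, hi⟩ := ht
    rw [prod_eq_zero (mem_univ i) (by simp [shiftedChoose, hi]), mul_zero]

theorem shiftedChoose_eq_zero {n t p : ℕ} (ht : t ≤ n) (hp : n < p) : shiftedChoose n t p = 0 := by
  rw [shiftedChoose, if_pos (by omega), Nat.choose_eq_zero_of_lt (by omega)]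

theorem Mcoeff_eq_zero {n k : ℕ} {p : Fin k → ℕ} {i : Fin k} (hi : n < p i) : Mcoeff n p = 0 := by
  rw [Mcoeff_eq n (by have := i.2; omega)]
  refine sum_eq_zero fun t ht => ?_
  rw [mem_range] at ht
  rw [prod_eq_zero (mem_univ i) (by rw [shiftedChoose_eq_zero (by omega) hi]; simp), mul_zero]

/-- Vandermonde, once C(n-t, p-t) is rewritten as C(n-t, n-p). -/
theorem sum_choose_mul_shiftedChoose {n t : ℕ} (ht : t ≤ n) (z : ℕ) :
    ∑ p ∈ range (n + 1), shiftedChoose n t p * z.choose p = (z + n - t).choose n := by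
  rw [Nat.add_sub_assoc ht, Nat.add_choose_eq,
    Nat.sum_antidiagonal_eq_sum_range_succ (fun i j => z.choose i * (n - t).choose j)]
  refine sum_congr rfl fun p hp => ?_
  rw [mem_range] at hp
  rw [mul_comm]
  congr 1
  rw [shiftedChoose]
  split_ifs with h
  · rw [← Nat.choose_symm_of_eq_add]
    omega
  · rw [Nat.choose_eq_zero_of_lt (by omega)]

theorem sum_Mcoeff_mul {n k : ℕ} (hk : 1 ≤ k) (z : Fin k → ℕ) :
    ∑ p ∈ Fintype.piFinset (fun _ : Fin k => range (n + 1)),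
      Mcoeff n p * ∏ i, ((z i).choose (p i) : ℤ) =
    ∑ t ∈ range (n + 1), (-1) ^ t * (n.choose t : ℤ) * ∏ i, ((z i + n - t).choose n : ℤ) := by
  simp only [Mcoeff_eq n hk, sum_mul]
  rw [sum_comm]
  refine sum_congr rfl fun t ht => ?_
  rw [mem_range] at ht
  simp only [mul_assoc, ← mul_sum, ← prod_mul_distrib]
  congr 2
  rw [← prod_univ_sum (fun _ => range (n + 1))
    (fun i p => (shiftedChoose n t p : ℤ) * ((z i).choose p : ℤ))]
  refine prod_congr rfl fun i _ => ?_
  rw [← sum_choose_mul_shiftedChoose (by omega : t ≤ n)]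
  push_cast
  rfl

/-- Inclusion–exclusion for the q-subsets of an n-set that avoid p given points; the induction
carries it out by Pascal's rule. -/
theorem sum_alternating_shiftedChoose (p : ℕ) : ∀ {n : ℕ} (_ : p ≤ n) (q : ℕ),
    ∑ t ∈ range (p + 1), (-1) ^ t * (p.choose t : ℤ) * (shiftedChoose n t q : ℤ) =
      (n - p).choose q := by
  induction p with
  | zero => intro n _ q; simp [shiftedChoose]
  | succ p ih =>
    intro n hn q
    rw [sum_alternating_choose_succ]
    simp only [mul_sub, sum_sub_distrib]
    rw [ih (by omega)]
    obtain ⟨n, rfl⟩ : ∃ l, n = l + 1 := ⟨n - 1, by omega⟩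
    rcases q with _ | q
    · simp [shiftedChoose]
    · have : ∀ t, shiftedChoose (n + 1) (t + 1) (q + 1) = shiftedChoose n t q := fun t => by
        simp [shiftedChoose]
      simp only [this]
      rw [ih (by omega), show n + 1 - p = (n - p) + 1 by omega, Nat.choose_succ_succ',
        show n + 1 - (p + 1) = n - p by omega]
      push_cast
      ring

theorem trinomial_eq (n p q : ℕ) : trinomial n p q = n.choose p * (n - p).choose q := by
  rw [trinomial]
  split_ifs with h
  · have h1 := Nat.multinomial_spec univ ![p, q, n - p - q]
    rw [Fin.prod_univ_three, Fin.sum_univ_three] at h1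
    simp only [Matrix.cons_val_zero, Matrix.cons_val_one, Matrix.cons_val] at h1
    rw [show p + q + (n - p - q) = n by omega] at h1
    have h2 := Nat.choose_mul_factorial_mul_factorial (show p ≤ n by omega)
    have h3 := Nat.choose_mul_factorial_mul_factorial (show q ≤ n - p by omega)
    refine Nat.eq_of_mul_eq_mul_left (show 0 < p.factorial * q.factorial * (n - p - q).factorial by
      positivity) ?_
    rw [h1, ← h2, ← h3]
    ring
  · rcases Nat.lt_or_ge n p with hp | hp
    · rw [Nat.choose_eq_zero_of_lt hp, zero_mul]
    · rw [Nat.choose_eq_zero_of_lt (show n - p < q by omega), mul_zero]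

/-- C(n,t) C(n-t,p-t) = C(n,p) C(p,t) pulls out C(n,p) and leaves the inclusion–exclusion sum. -/
theorem Mcoeff_pair (n p q : ℕ) : Mcoeff n ![p, q] = trinomial n p q := by
  rw [trinomial_eq]
  rcases Nat.lt_or_ge n p with hp | hp
  · rw [Nat.choose_eq_zero_of_lt hp, zero_mul, Mcoeff_eq_zero (i := 0) (by simpa using hp)]
    rfl
  · rw [Mcoeff_eq n (by norm_num), Nat.cast_mul, ← sum_alternating_shiftedChoose p hp q, mul_sum]
    symm
    refine sum_subset_zero_on_sdiff (range_mono (by omega)) ?_ ?_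
    · intro t ht
      simp only [mem_sdiff, mem_range] at ht
      simp [Fin.prod_univ_two, shiftedChoose, show ¬t ≤ p by omega]
    · intro t ht
      rw [mem_range] at ht
      have h := Nat.choose_mul (n := n) (k := p) (s := t) (by omega)
      have h' : (n.choose p : ℤ) * p.choose t = n.choose t * (n - t).choose (p - t) := by
        exact_mod_cast h
      simp only [Fin.prod_univ_two, Matrix.cons_val_zero, Matrix.cons_val_one]
      rw [show shiftedChoose n t p = (n - t).choose (p - t) by
        rw [shiftedChoose, if_pos (by omega)]]
      linear_combination ((-1) ^ t * (shiftedChoose n t q : ℤ)) * h'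

theorem hookContent_succ (n r : ℕ) (z : ℂ) : hookContent n r z = hookContent n (r + 1) (z + 1) :=
  prod_congr rfl fun l _ => by push_cast; ring

theorem hookContent_natCast {n t : ℕ} (ht : t ≤ n) (z : ℕ) :
    hookContent n t ((z : ℂ) + 1) = n.factorial * ((z + n - t).choose n : ℕ) := by
  rw [← Nat.cast_mul, ← Nat.descFactorial_eq_factorial_mul_choose]
  rw [← descPochhammer_eval_eq_descFactorial ℂ, descPochhammer_eval_eq_prod_range, hookContent,
    ← prod_range_reflect]
  refine prod_congr rfl fun l hl => ?_
  rw [mem_range] at hl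
  rw [Nat.cast_sub (by omega : l ≤ n - 1), Nat.cast_sub (by omega : 1 ≤ n),
    Nat.cast_sub (by omega : t ≤ z + n)]
  push_cast
  ring

end

/-! ### The factorization identity -/

section

variable {d n : ℕ}

/-- The content products at z and z + 1 differ by a shift of r, so the difference of the two hook
sums over C(m,r) merges into one sum over C(m+1,t). -/
theorem weightedCount_coxeter [NeZero d] {m k : ℕ} (hk : 1 ≤ k) (z : Fin k → ℕ)
    {π : Perm (Fin (m + 1))} (hπ : IsTransitive π) {a : Fin (m + 1) → rootsOfUnity d ℂ}
    (ha : ∏ i, a i ≠ 1) :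
    weightedCount (fun i => 1 + (d : ℂ) * z i) (gdEquiv d (m + 1) (π, a)) =
      ((d ^ (m + 1) * (m + 1).factorial : ℕ) : ℂ) ^ (k - 1) *
        ∑ t ∈ range (m + 2), (-1) ^ t * ((m + 1).choose t : ℂ) *
          ∏ i, ((z i + (m + 1) - t).choose (m + 1) : ℂ) := by
  have h1 := weightedCount_eq (d := d) (fun i => (z i : ℂ)) hπ ha
  have h2 := factorial_mul_coeff (List.ofFn fun i => (z i : ℂ) + 1) hπ
  have h3 := factorial_mul_coeff (List.ofFn fun i => (z i : ℂ)) hπ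
  have hdiff := congrArg₂ (· - ·) h2 h3
  simp only [← mul_sub, ← sum_sub_distrib, List.map_ofFn, List.prod_ofFn, Function.comp_def,
    hookContent_succ (m + 1) _ ((z _ : ℕ) : ℂ)] at hdiff
  rw [← sum_alternating_choose_succ m
    (fun r => ∏ i, hookContent (m + 1) r ((z i : ℂ) + 1))] at hdiff
  have h4 : ∀ t ∈ range (m + 2), (-1) ^ t * ((m + 1).choose t : ℂ) *
      ∏ i, hookContent (m + 1) t ((z i : ℂ) + 1) = ((m + 1).factorial : ℂ) ^ k *
        ((-1) ^ t * ((m + 1).choose t : ℂ) *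
          ∏ i, ((z i + (m + 1) - t).choose (m + 1) : ℂ)) := by
    intro t ht
    rw [mem_range] at ht
    rw [prod_congr rfl fun i _ => hookContent_natCast (by omega : t ≤ m + 1) (z i),
      prod_mul_distrib, prod_const, card_univ, Fintype.card_fin]
    ring
  rw [sum_congr rfl h4, ← mul_sum] at hdiff
  have hd : (d : ℂ) ≠ 0 := Nat.cast_ne_zero.2 (NeZero.ne d)
  have hf : ((m + 1).factorial : ℂ) ≠ 0 := Nat.cast_ne_zero.2 (Nat.factorial_ne_zero _)
  obtain ⟨k, rfl⟩ : ∃ l, k = l + 1 := ⟨k - 1, by omega⟩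
  refine mul_left_cancel₀ (mul_ne_zero (pow_ne_zero (m + 1) hd) hf) ?_
  simp only [List.map_ofFn, Function.comp_def] at h1
  rw [mul_right_comm, h1, mul_right_comm, mul_assoc, mul_comm _ ((m + 1).factorial : ℂ), hdiff]
  push_cast
  ring

theorem sum_factorCount_mul [NeZero d] (g : Gd1n d n) {k : ℕ} (x : Fin k → ℂ) :
    ∑ r ∈ Fintype.piFinset (fun _ : Fin k => range (n + 1)),
      (factorCount (Gd1n d n) (g : GL (Fin n) ℂ) r : ℂ) * ∏ i, x i ^ r i = weightedCount x g := by
  classical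
  have hcount : ∀ r : Fin k → ℕ, factorCount (Gd1n d n) (g : GL (Fin n) ℂ) r =
      ((univ.filter fun u : Fin k → Gd1n d n => (List.ofFn u).prod = g).filter
        fun u => (fun i => fixDim (u i : GL (Fin n) ℂ)) = r).card := by
    intro r
    rw [factorCount, Nat.card_eq_fintype_card, Fintype.card_subtype, filter_filter]
    congr 1
    ext u
    simp only [mem_filter, mem_univ, true_and, funext_iff]
    refine and_congr_left fun _ => ?_
    rw [← Subtype.coe_inj, ← Subgroup.coe_subtype, map_list_prod, List.map_ofFn]
    rfl
  rw [weightedCount, ← sum_fiberwise_of_maps_to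
    (g := fun (u : Fin k → Gd1n d n) i => fixDim (u i : GL (Fin n) ℂ))
    (t := Fintype.piFinset (fun _ : Fin k => range (n + 1)))]
  · refine sum_congr rfl fun r _ => ?_
    rw [hcount, ← nsmul_eq_mul, ← sum_const]
    refine sum_congr (by congr!) fun u hu => ?_
    have := (mem_filter.1 hu).2
    rw [← this]
  · intro u _
    rw [Fintype.mem_piFinset]
    intro i
    rw [mem_range, Nat.lt_succ_iff]
    exact fixDim_le _

theorem mem_of_factorCount_ne_zero {c : GL (Fin n) ℂ} {k : ℕ} {r : Fin k → ℕ}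
    (h : factorCount (Gd1n d n) c r ≠ 0) :
    r ∈ Fintype.piFinset (fun _ : Fin k => range (n + 1)) := by
  obtain ⟨⟨u, -, hu⟩⟩ := (Nat.card_ne_zero.1 h).1
  rw [Fintype.mem_piFinset]
  intro i
  rw [mem_range, Nat.lt_succ_iff, ← hu i]
  exact fixDim_le _

theorem mem_of_Mcoeff_ne_zero {k : ℕ} {p : Fin k → ℕ} (h : Mcoeff n p ≠ 0) :
    p ∈ Fintype.piFinset (fun _ : Fin k => range (n + 1)) := by
  rw [Fintype.mem_piFinset]
  intro i
  rw [mem_range]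
  by_contra hi
  exact h (Mcoeff_eq_zero (i := i) (by omega))

theorem eval_normBasisPoly {ι : Type} (hd : d ≠ 0) (p : ℕ) (i : ι) (z : ι → ℕ) :
    MvPolynomial.eval (fun j => 1 + (d : ℚ) * z j) (normBasisPoly d p i) = ((z i).choose p : ℚ) := by
  have hd' : (d : ℚ) ≠ 0 := Nat.cast_ne_zero.2 hd
  have hp : (p.factorial : ℚ) ≠ 0 := Nat.cast_ne_zero.2 (Nat.factorial_ne_zero _)
  rw [normBasisPoly, basisPoly, map_mul, MvPolynomial.eval_C, map_prod]
  have h1 : ∏ j ∈ range p, MvPolynomial.eval (fun j => 1 + (d : ℚ) * z j)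
      (MvPolynomial.X i - 1 - MvPolynomial.C ((j : ℚ) * (d : ℚ))) =
      (d : ℚ) ^ p * ∏ j ∈ range p, ((z i : ℚ) - j) := by
    have : ∀ j ∈ range p, MvPolynomial.eval (fun j => 1 + (d : ℚ) * z j)
      (MvPolynomial.X i - 1 - MvPolynomial.C ((j : ℚ) * (d : ℚ))) = d * ((z i : ℚ) - j) := by
      intro j _
      simp only [map_sub, MvPolynomial.eval_X, map_one, MvPolynomial.eval_C]
      ring
    rw [prod_congr rfl this, prod_mul_distrib, prod_const, card_range]
  rw [h1, ← descPochhammer_eval_eq_prod_range, descPochhammer_eval_eq_descFactorial,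
    Nat.descFactorial_eq_factorial_mul_choose]
  push_cast
  field_simp

theorem factorization_identity (hd : 1 < d) {c : GL (Fin n) ℂ}
    (hc : IsCoxeterElement (Gd1n d n) c) {k : ℕ} (hk : 1 ≤ k) :
    MvPolynomial.C (1 / (Nat.card (Gd1n d n) : ℚ) ^ (k - 1)) *
        ∑ᶠ r : Fin k → ℕ, MvPolynomial.C (factorCount (Gd1n d n) c r : ℚ) *
          ∏ i, MvPolynomial.X i ^ r i
      = ∑ᶠ p : Fin k → ℕ, MvPolynomial.C (Mcoeff n p : ℚ) * ∏ i, normBasisPoly d (p i) i := by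
  have : NeZero d := ⟨by omega⟩
  obtain ⟨hn, π, a, hca, hπ, ha⟩ := coxeter_structure hd hc
  obtain ⟨m, rfl⟩ : ∃ m, n = m + 1 := ⟨n - 1, by omega⟩
  obtain rfl : c = (gdEquiv d (m + 1) (π, a) : GL (Fin (m + 1)) ℂ) := Units.ext hca
  rw [finsum_eq_sum_of_support_subset (s := Fintype.piFinset fun _ : Fin k => range (m + 1 + 1)),
    finsum_eq_sum_of_support_subset (s := Fintype.piFinset fun _ : Fin k => range (m + 1 + 1))]
  rotate_left
  · intro p hp
    refine mem_of_Mcoeff_ne_zero fun h => hp ?_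
    simp [h]
  · intro r hr
    refine mem_of_factorCount_ne_zero (d := d) (c := gdEquiv d (m + 1) (π, a)) fun h => hr ?_
    simp [h]
  -- Sampling at x_i = 1 + d z_i with z_i natural turns the basis polynomials into binomial
  -- coefficients C(z_i, p_i).
  refine MvPolynomial.funext_set (fun _ => Set.range fun z : ℕ => 1 + (d : ℚ) * z) ?_ ?_
  · intro i
    refine Set.infinite_range_of_injective fun y z hyz => ?_
    have hd' : (d : ℚ) ≠ 0 := Nat.cast_ne_zero.2 (NeZero.ne d)
    simpa [hd'] using hyz
  · intro x hx
    choose z hz using fun i => hx i (Set.mem_univ i)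
    obtain rfl : (fun i => 1 + (d : ℚ) * z i) = x := funext hz
    have hW := sum_factorCount_mul (gdEquiv d (m + 1) (π, a)) fun i => 1 + (d : ℂ) * z i
    rw [weightedCount_coxeter hk z hπ ha] at hW
    have hM := sum_Mcoeff_mul (n := m + 1) hk z
    have hW' : ∑ r ∈ Fintype.piFinset (fun _ : Fin k => range (m + 1 + 1)),
        (factorCount (Gd1n d (m + 1)) (gdEquiv d (m + 1) (π, a) : GL (Fin (m + 1)) ℂ) r : ℚ) *
          ∏ i, (1 + (d : ℚ) * z i) ^ r i =
        ((d ^ (m + 1) * (m + 1).factorial : ℕ) : ℚ) ^ (k - 1) *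
        ∑ t ∈ range (m + 2), (-1) ^ t * ((m + 1).choose t : ℚ) *
          ∏ i, ((z i + (m + 1) - t).choose (m + 1) : ℚ) := by
      have hinj : Function.Injective (Rat.cast : ℚ → ℂ) := Rat.cast_injective
      apply hinj
      push_cast at hW ⊢
      exact hW
    have hM' : ∑ p ∈ Fintype.piFinset (fun _ : Fin k => range (m + 1 + 1)),
        (Mcoeff (m + 1) p : ℚ) * ∏ i, ((z i).choose (p i) : ℚ) =
        ∑ t ∈ range (m + 2), (-1) ^ t * ((m + 1).choose t : ℚ) *
          ∏ i, ((z i + (m + 1) - t).choose (m + 1) : ℚ) := by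
      exact_mod_cast hM
    simp only [map_mul, map_sum, map_prod, map_pow, MvPolynomial.eval_C, MvPolynomial.eval_X,
      eval_normBasisPoly (NeZero.ne d)]
    rw [hM', hW', Nat.card_eq_fintype_card, card_Gd1n, ← mul_assoc, one_div, inv_mul_cancel₀,
      one_mul]
    refine pow_ne_zero _ (Nat.cast_ne_zero.2 ?_)
    exact mul_ne_zero (pow_ne_zero _ (NeZero.ne d)) (Nat.factorial_ne_zero _)

theorem finite_factorCount (c : GL (Fin n) ℂ) (k : ℕ) :
    {r : Fin k → ℕ | factorCount (Gd1n d n) c r ≠ 0}.Finite :=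
  (Fintype.piFinset fun _ : Fin k => range (n + 1)).finite_toSet.subset
    fun _ hr => mem_of_factorCount_ne_zero hr

theorem finite_Mcoeff (n k : ℕ) : {p : Fin k → ℕ | Mcoeff n p ≠ 0}.Finite :=
  (Fintype.piFinset fun _ : Fin k => range (n + 1)).finite_toSet.subset
    fun _ hp => mem_of_Mcoeff_ne_zero hp

theorem finite_pairs {P : (Fin 2 → ℕ) → Prop} (h : {r | P r}.Finite) :
    {rs : ℕ × ℕ | P ![rs.1, rs.2]}.Finite :=
  h.preimage (f := fun rs : ℕ × ℕ => ![rs.1, rs.2]) fun _ _ _ _ hxy =>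
    Prod.ext (congrFun hxy 0) (congrFun hxy 1)

end

end ReflFact

end

/-- Factorizations of an arbitrary Coxeter element `c` of `G(d, 1, n)`, counted by the fixed space
dimensions of the factors. The formal sums run over all tuples of nonnegative integers; that they
are finite sums is part of the claim. -/
theorem theorem1p3 (d n : ℕ) (hd : 1 < d) (c : Matrix.GeneralLinearGroup (Fin n) ℂ)
    (hc : ReflFact.IsCoxeterElement (ReflFact.Gd1n d n) c) :
    ({rs : ℕ × ℕ | ReflFact.factorCount (ReflFact.Gd1n d n) c ![rs.1, rs.2] ≠ 0}.Finite ∧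
      {pq : ℕ × ℕ | ReflFact.trinomial n pq.1 pq.2 ≠ 0}.Finite ∧
      MvPolynomial.C (1 / (Nat.card (ReflFact.Gd1n d n) : ℚ)) *
          ∑ᶠ rs : ℕ × ℕ,
            MvPolynomial.C (ReflFact.factorCount (ReflFact.Gd1n d n) c ![rs.1, rs.2] : ℚ) *
              MvPolynomial.X (0 : Fin 2) ^ rs.1 * MvPolynomial.X (1 : Fin 2) ^ rs.2
        = ∑ᶠ pq : ℕ × ℕ,
            MvPolynomial.C (ReflFact.trinomial n pq.1 pq.2 : ℚ) *
              ReflFact.normBasisPoly d pq.1 (0 : Fin 2) *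
              ReflFact.normBasisPoly d pq.2 (1 : Fin 2)) ∧
    (∀ k : ℕ, 1 ≤ k →
      {r : Fin k → ℕ | ReflFact.factorCount (ReflFact.Gd1n d n) c r ≠ 0}.Finite ∧
      {p : Fin k → ℕ | ReflFact.Mcoeff n p ≠ 0}.Finite ∧
      MvPolynomial.C (1 / (Nat.card (ReflFact.Gd1n d n) : ℚ) ^ (k - 1)) *
          ∑ᶠ r : Fin k → ℕ,
            MvPolynomial.C (ReflFact.factorCount (ReflFact.Gd1n d n) c r : ℚ) *
              ∏ i, MvPolynomial.X i ^ r i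
        = ∑ᶠ p : Fin k → ℕ,
            MvPolynomial.C (ReflFact.Mcoeff n p : ℚ) *
              ∏ i, ReflFact.normBasisPoly d (p i) i) := by
  refine ⟨⟨ReflFact.finite_pairs (ReflFact.finite_factorCount c 2), ?_, ?_⟩, fun k hk =>
    ⟨ReflFact.finite_factorCount c k, ReflFact.finite_Mcoeff n k,
      ReflFact.factorization_identity hd hc hk⟩⟩
  · refine (ReflFact.finite_pairs (ReflFact.finite_Mcoeff n 2)).subset fun pq hpq => ?_
    rw [Set.mem_ofPred_eq, ReflFact.Mcoeff_pair]
    exact Int.natCast_ne_zero.2 hpq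
  · have h := ReflFact.factorization_identity hd hc (k := 2) (by norm_num)
    rw [← finsum_comp_equiv (finTwoArrowEquiv ℕ).symm,
      ← finsum_comp_equiv (finTwoArrowEquiv ℕ).symm] at h
    simp only [finTwoArrowEquiv_symm_apply, Fin.prod_univ_two, Matrix.cons_val_zero,
      Matrix.cons_val_one, ReflFact.Mcoeff_pair, Int.cast_natCast, ← mul_assoc, pow_one,
      Nat.add_one_sub_one] at h
    exact h
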